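/- Let $k$ be an algebraically closed field of characteristic zero, $V$ a finite-dimensional $k$-vector space of dimension $n$, and $R=\operatorname{Sym}(V^*)$. For $P\in V$ let $\mathfrak m_P\subseteq R$ be the maximal ideal of functions vanishing at $P$, and let $$\mathrm{LC}(V,P)=H^n_{\mathfrak m_P}(R,\Omega^n_{R/k})$$ be the top local cohomology module, whose elements are linear combinations of generalised fractions $\left[\frac{\omega}{t_1,\ldots,t_n}\right]$. It carries the residue map $\operatorname{res}_P:\mathrm{LC}(V,P)\to k$, and $\eta\mapsto \operatorname{res}_P((-)\,\eta)$ identifies $\mathrm{LC}(V,P)$ with the space of linear maps $R\to k$ vanishing on a power of $\mathfrak m_P$. Through this identification: * $\mathrm{LC}(V,P)$ is a coalgebra with counit $\operatorname{res}_P$ and coproduct dual to the multiplication of $R$; * each $\nu\in V$ acts on $\mathrm{LC}(V,P)$ by the operator $\partial_\nu$ determined by $\operatorname{res}_P(f\cdot\partial_\nu\eta)=\operatorname{res}_P(\partial_\nu(f)\,\eta)$ for all $f\in R$, where $\partial_\nu$ acts on $R$ as the directional derivative. Put $|0\rangle_P=\left[\frac{dz_1\wedge\cdots\wedge dz_n}{z_1,\ldots,z_n}\right]$,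 where $z_i=x_i-x_i(P)$ for linear coordinates $x_1,\dots,x_n$ on $V$, and $|\nu_1,\ldots,\nu_s\rangle_P=\partial_{\nu_1}\cdots\partial_{\nu_s}|0\rangle_P$. Let ${!}V=\bigoplus_{P\in V}\mathrm{LC}(V,P)$ be the direct sum coalgebra. The dereliction $d:{!}V\to V$ is the linear map $d=\sum_P d_P$, where $d_P:\mathrm{LC}(V,P)\to V$ is determined by $\varphi(d_P(\eta))=\operatorname{res}_P(\varphi\,\eta)$ for $\varphi\in V^*\subseteq R$. **Lemma.** There is a canonical isomorphism of coalgebras $$\Psi:\;{!}V\;\longrightarrow\;\bigoplus_{P\in V}\operatorname{Sym}_P(V),$$ where $\operatorname{Sym}_P(V)=\operatorname{Sym}(V)$ is the symmetric coalgebra (every $v\in V$ is primitive and the coproduct is multiplicative). It sends $|\nu_1,\ldots,\nu_s\rangle_P$ to the product $\nu_1\cdots\nu_s$ in the summand $\operatorname{Sym}_P(V)$, for all $P,\nu_1,\ldots,\nu_s\in V$ and $s\ge 0$. If $$c_P:\operatorname{Sym}_P(V)\to V,\qquad c_P(v_0,v_1,v_2,\ldots)=v_0\cdot P+v_1,$$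 where $v_i$ is the component of degree $i$, then $d=\big(\sum_P c_P\big)\circ\Psi$. -/

import Mathlib

namespace CofreeCoalgebra

open scoped TensorProduct

namespace MvAux
variable {k : Type*} [Field k] {n : ℕ}

theorem mem_span_pow (p : ℕ) (s : Set (Fin n)) (g : MvPolynomial (Fin n) k) :
    g ∈ Ideal.span ((fun i => (MvPolynomial.X i : MvPolynomial (Fin n) k) ^ p) '' s) ↔
      ∀ a, (∀ i ∈ s, a i < p) → g.coeff a = 0 := by
  have h : ((fun i => (MvPolynomial.X i : MvPolynomial (Fin n) k) ^ p) '' s) =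
      (fun a => MvPolynomial.monomial a (1 : k)) '' ((fun i => Finsupp.single i p) '' s) := by
    rw [Set.image_image]
    simp [MvPolynomial.X_pow_eq_monomial]
  rw [h, MvPolynomial.mem_ideal_span_monomial_image]
  constructor
  · intro H a ha
    by_contra hne
    obtain ⟨_, ⟨i, hi, rfl⟩, hle⟩ := H a (MvPolynomial.mem_support_iff.2 hne)
    have := hle i
    simp at this
    exact absurd (ha i hi) (by omega)
  · intro H a ha
    by_contra! hne
    refine MvPolynomial.mem_support_iff.1 ha (H a fun i hi => ?_)
    by_contra! hlt
    exact hne _ ⟨i, hi, rfl⟩ (by simpa using hlt)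

theorem regular_pow (p : ℕ) (i : Fin n) (g : MvPolynomial (Fin n) k)
    (h : (MvPolynomial.X i : MvPolynomial (Fin n) k) ^ p * g ∈
      Ideal.span ((fun i => (MvPolynomial.X i : MvPolynomial (Fin n) k) ^ p) '' {i}ᶜ)) :
    g ∈ Ideal.span ((fun i => (MvPolynomial.X i : MvPolynomial (Fin n) k) ^ p) '' {i}ᶜ) := by
  rw [mem_span_pow] at h ⊢
  intro a ha
  have := h (Finsupp.single i p + a) fun j hj => by
    have : j ≠ i := hj
    simpa [Finsupp.single_apply, this.symm] using ha j hj
  rwa [MvPolynomial.X_pow_eq_monomial, MvPolynomial.coeff_monomial_mul, one_mul] at this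

open Matrix in
theorem det_mem (p : ℕ) (t : Fin n → MvPolynomial (Fin n) k)
    (M : Matrix (Fin n) (Fin n) (MvPolynomial (Fin n) k)) (i : Fin n)
    (hM : ∀ l, l ≠ i → (M *ᵥ t) l = MvPolynomial.X l ^ p) (hi : (M *ᵥ t) i = 0)
    (a : Fin n → MvPolynomial (Fin n) k) (ha : a ⬝ᵥ t = MvPolynomial.X i ^ p) :
    M.det ∈ Ideal.span ((fun i => (MvPolynomial.X i : MvPolynomial (Fin n) k) ^ p) '' {i}ᶜ) := by
  apply regular_pow
  have key : ∀ j, t j * M.det ∈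
      Ideal.span ((fun i => (MvPolynomial.X i : MvPolynomial (Fin n) k) ^ p) '' {i}ᶜ) := by
    intro j
    have h1 : M.adjugate *ᵥ (M *ᵥ t) = M.det • t := by
      rw [mulVec_mulVec, adjugate_mul, smul_mulVec, one_mulVec]
    have h2 : t j * M.det = ∑ l, M.adjugate j l * (M *ᵥ t) l := by
      have := congrFun h1 j
      simp only [Pi.smul_apply, smul_eq_mul] at this
      rw [mul_comm, ← this]; rfl
    rw [h2]
    refine Ideal.sum_mem _ fun l _ => Ideal.mul_mem_left _ _ ?_
    by_cases hl : l = i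
    · rw [hl, hi]; exact Ideal.zero_mem _
    · rw [hM l hl]; exact Ideal.subset_span ⟨l, hl, rfl⟩
  rw [← ha, dotProduct, Finset.sum_mul]
  refine Ideal.sum_mem _ fun j _ => ?_
  rw [mul_assoc]
  exact Ideal.mul_mem_left _ _ (key j)

open Matrix in
theorem det_sub_mem (p : ℕ) (t : Fin n → MvPolynomial (Fin n) k)
    (A B : Matrix (Fin n) (Fin n) (MvPolynomial (Fin n) k))
    (hA : A *ᵥ t = fun i => MvPolynomial.X i ^ p) (hB : B *ᵥ t = fun i => MvPolynomial.X i ^ p) :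
    A.det - B.det ∈ Ideal.span ((fun i => (MvPolynomial.X i : MvPolynomial (Fin n) k) ^ p) ''
      Set.univ) := by
  classical
  have key : ∀ s : Finset (Fin n), (Matrix.of fun i => if i ∈ s then A i else B i).det - B.det ∈
      Ideal.span ((fun i => (MvPolynomial.X i : MvPolynomial (Fin n) k) ^ p) '' Set.univ) := by
    intro s
    induction s using Finset.induction_on with
    | empty =>
      have : (Matrix.of fun i => if i ∈ (∅ : Finset (Fin n)) then A i else B i) = B := by
        ext; simp
      rw [this]; simp
    | insert i s hi ih =>
      set M : Matrix (Fin n) (Fin n) (MvPolynomial (Fin n) k) :=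
        Matrix.of fun i => if i ∈ s then A i else B i with hMdef
      have hMt : M *ᵥ t = fun i => MvPolynomial.X i ^ p := by
        funext l
        by_cases hl : l ∈ s
        · have : (M *ᵥ t) l = (A *ᵥ t) l := by simp [mulVec, hMdef, hl]
          rw [this, hA]
        · have : (M *ᵥ t) l = (B *ᵥ t) l := by simp [mulVec, hMdef, hl]
          rw [this, hB]
      have h1 : (Matrix.of fun j => if j ∈ insert i s then A j else B j) = M.updateRow i (A i) := by
        ext j l
        by_cases hj : j = i
        · subst hj; simp
        · simp [hMdef, hj, updateRow_ne]
      have h2 : (M.updateRow i (A i)).det = (M.updateRow i (A i - B i)).det + M.det := by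
        have h3 : M = M.updateRow i (B i) := by
          ext j l
          by_cases hj : j = i
          · subst hj; simp [hMdef, hi]
          · simp [updateRow_ne, hj]
        conv_rhs => rw [h3, updateRow_idem]
        rw [← det_updateRow_add, sub_add_cancel]
      rw [h1, h2, add_sub_assoc]
      refine Ideal.add_mem _ ?_ ih
      refine Ideal.span_mono (Set.image_mono (Set.subset_univ _)) (det_mem p t _ i ?_ ?_ (A i) ?_)
      · intro l hl
        have : (M.updateRow i (A i - B i) *ᵥ t) l = (M *ᵥ t) l := by
          simp [mulVec, updateRow_ne hl]
        rw [this, hMt]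
      · simp only [mulVec, updateRow_self, sub_dotProduct]
        have ha := congrFun hA i
        have hb := congrFun hB i
        simp only [mulVec] at ha hb
        rw [ha, hb, sub_self]
      · exact congrFun hA i
  have := key Finset.univ
  have h : (Matrix.of fun i => if i ∈ (Finset.univ : Finset (Fin n)) then A i else B i) = A := by
    ext; simp
  rwa [h] at this

end MvAux

section GeneralisedFractions

variable {R : Type*} [CommRing R]

/-- Sequences `t₁, …, tₙ` whose common zero locus is exactly that of the ideal `m`:
`m ^ N ≤ (t₁, …, tₙ) ≤ m` for some `N`. These are the denominators of generalised fractions. -/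
structure ParamSystem (m : Ideal R) (n : ℕ) where
  /-- the sequence -/
  seq : Fin n → R
  span_le : Ideal.span (Set.range seq) ≤ m
  pow_le : ∃ N : ℕ, m ^ N ≤ Ideal.span (Set.range seq)

/-- The relations between generalised fractions `[ω / t₁, …, tₙ]`: a fraction vanishes when its
numerator is a multiple of one of the `tᵢ`, and `[ω / t] = [det A • ω / t']` when `t' = A t`. -/
noncomputable def fracRelations (m : Ideal R) (n : ℕ) (M : Type*) [AddCommGroup M] [Module R M] :
    Submodule R (ParamSystem m n →₀ M) :=
  Submodule.span R
    ({x | ∃ (t : ParamSystem m n) (i : Fin n) (ω : M), x = Finsupp.single t (t.seq i • ω)} ∪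
     {x | ∃ (t t' : ParamSystem m n) (A : Matrix (Fin n) (Fin n) R) (ω : M),
        t'.seq = A.mulVec t.seq ∧ x = Finsupp.single t ω - Finsupp.single t' (A.det • ω)})

/-- The top local cohomology module `Hⁿ_m(M)`, for `m` the radical of an ideal generated by `n`
elements, presented as the colimit of the top Koszul cohomology modules `M / (t₁, …, tₙ) M` over
all systems of parameters `t`, the transition map for `t' = A t` being multiplication by `det A`
(the module of generalised fractions). -/
def TopLocalCohomology (m : Ideal R) (n : ℕ) (M : Type*) [AddCommGroup M] [Module R M] : Type _ :=
  (ParamSystem m n →₀ M) ⧸ fracRelations m n M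

namespace TopLocalCohomology

variable {m : Ideal R} {n : ℕ} {M : Type*} [AddCommGroup M] [Module R M]

noncomputable instance : AddCommGroup (TopLocalCohomology m n M) :=
  inferInstanceAs (AddCommGroup ((ParamSystem m n →₀ M) ⧸ fracRelations m n M))

noncomputable instance : Module R (TopLocalCohomology m n M) :=
  inferInstanceAs (Module R ((ParamSystem m n →₀ M) ⧸ fracRelations m n M))

/-- The generalised fraction `[ω / t₁, …, tₙ]`, linear in the numerator. -/
noncomputable def frac (t : ParamSystem m n) : M →ₗ[R] TopLocalCohomology m n M :=
  (fracRelations m n M).mkQ ∘ₗ Finsupp.lsingle t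

theorem frac_smul_seq (t : ParamSystem m n) (i : Fin n) (ω : M) : frac t (t.seq i • ω) = 0 :=
  (Submodule.Quotient.mk_eq_zero _).2 (Submodule.subset_span (Or.inl ⟨t, i, ω, rfl⟩))

theorem frac_eq (t t' : ParamSystem m n) (A : Matrix (Fin n) (Fin n) R)
    (h : t'.seq = A.mulVec t.seq) (ω : M) : frac t ω = frac t' (A.det • ω) :=
  (Submodule.Quotient.eq _).2 (Submodule.subset_span (Or.inr ⟨t, t', A, ω, h, rfl⟩))

theorem induction_frac {p : TopLocalCohomology m n M → Prop} (h0 : p 0)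
    (hadd : ∀ x y, p x → p y → p (x + y)) (hf : ∀ t ω, p (frac t ω)) (x) : p x := by
  obtain ⟨x, rfl⟩ := Submodule.Quotient.mk_surjective _ x
  induction x using Finsupp.induction_linear with
  | zero => exact h0
  | add f g hf hg => exact hadd _ _ hf hg
  | single t ω => exact hf t ω

/-- Additive maps out of the module of generalised fractions. -/
noncomputable def liftAdd {G : Type*} [AddCommGroup G] (F : ParamSystem m n → M →+ G)
    (h1 : ∀ t i ω, F t (t.seq i • ω) = 0)
    (h2 : ∀ t t' (A : Matrix (Fin n) (Fin n) R), t'.seq = A.mulVec t.seq →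
      ∀ ω, F t ω = F t' (A.det • ω)) : TopLocalCohomology m n M →+ G :=
  QuotientAddGroup.lift (fracRelations m n M).toAddSubgroup (Finsupp.liftAddHom F) (by
    intro x hx
    have key : ∀ r : R, Finsupp.liftAddHom F (r • x) = 0 := by
      refine Submodule.span_induction (p := fun x _ => ∀ r : R, Finsupp.liftAddHom F (r • x) = 0)
        ?_ ?_ ?_ ?_ hx
      · rintro _ (⟨t, i, ω, rfl⟩ | ⟨t, t', A, ω, h, rfl⟩) r
        · rw [Finsupp.smul_single, smul_comm, Finsupp.liftAddHom_apply_single, h1]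
        · rw [smul_sub, Finsupp.smul_single, Finsupp.smul_single, map_sub,
            Finsupp.liftAddHom_apply_single, Finsupp.liftAddHom_apply_single, smul_comm,
            h2 t t' A h, sub_self]
      · simp
      · intro x y _ _ hx hy r
        rw [smul_add, map_add, hx, hy, add_zero]
      · intro a x _ hx r
        rw [smul_smul, hx]
    simpa using key 1)

theorem liftAdd_frac {G : Type*} [AddCommGroup G] (F : ParamSystem m n → M →+ G) (h1 h2)
    (t : ParamSystem m n) (ω : M) : liftAdd F h1 h2 (frac t ω) = F t ω := by
  refine (QuotientAddGroup.lift_mk' _ _ _).trans ?_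
  exact Finsupp.liftAddHom_apply_single F t ω

end TopLocalCohomology

end GeneralisedFractions

section SymDual

open scoped KaehlerDifferential
open Module

variable (k : Type*) {V : Type*} [Field k] [AddCommGroup V] [Module k V]

variable (V) in
/-- The symmetric algebra `R = Sym(V*)`: polynomial functions on `V`. -/
abbrev SymDual := SymmetricAlgebra k (Module.Dual k V)

/-- Evaluation of polynomial functions at a point `P`. -/
noncomputable def evalAt (P : V) : SymDual k V →ₐ[k] k :=
  SymmetricAlgebra.lift (Module.Dual.eval k V P)

/-- The maximal ideal `m_P` of functions vanishing at `P`. -/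
noncomputable def maxIdeal (P : V) : Ideal (SymDual k V) := RingHom.ker (evalAt k P)

variable (V) in
/-- The module of top-degree differential forms `Ωⁿ` of `R` over `k`, with `n = dim V`. -/
noncomputable abbrev TopForms := ⋀[SymDual k V]^(finrank k V) Ω[SymDual k V⁄k]

/-- The local cohomology module `LC(V, P) = Hⁿ_{m_P}(R, Ωⁿ)`, with `n = dim V`. -/
noncomputable def LC (P : V) : Type _ := TopLocalCohomology (maxIdeal k P) (finrank k V) (TopForms k V)

namespace LC
variable {k} {P : V}

noncomputable instance : AddCommGroup (LC k P) :=
  inferInstanceAs (AddCommGroup (TopLocalCohomology (maxIdeal k P) (finrank k V) (TopForms k V)))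

noncomputable instance : Module (SymDual k V) (LC k P) :=
  inferInstanceAs (Module (SymDual k V)
    (TopLocalCohomology (maxIdeal k P) (finrank k V) (TopForms k V)))

noncomputable instance : Module k (LC k P) := Module.compHom _ (algebraMap k (SymDual k V))

instance : IsScalarTower k (SymDual k V) (LC k P) where
  smul_assoc c f η := by
    rw [Algebra.smul_def, mul_smul]; rfl

instance : SMulCommClass k (SymDual k V) (LC k P) where
  smul_comm c f η := smul_comm (algebraMap k (SymDual k V) c) f η

/-- The generalised fraction `[ω / t₁, …, tₙ]` in `LC(V, P)`. -/
noncomputable def frac (t : ParamSystem (maxIdeal k P) (finrank k V)) :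
    TopForms k V →ₗ[SymDual k V] LC k P :=
  TopLocalCohomology.frac t

theorem frac_smul_seq (t : ParamSystem (maxIdeal k P) (finrank k V)) (i) (ω : TopForms k V) :
    (frac t (t.seq i • ω) : LC k P) = 0 :=
  TopLocalCohomology.frac_smul_seq t i ω

theorem frac_eq (t t' : ParamSystem (maxIdeal k P) (finrank k V))
    (A : Matrix (Fin (finrank k V)) (Fin (finrank k V)) (SymDual k V))
    (h : t'.seq = A.mulVec t.seq) (ω : TopForms k V) :
    (frac t ω : LC k P) = frac t' (A.det • ω) :=
  TopLocalCohomology.frac_eq t t' A h ω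

theorem induction_frac {p : LC k P → Prop} (h0 : p 0) (hadd : ∀ x y, p x → p y → p (x + y))
    (hf : ∀ t ω, p (frac t ω)) (x : LC k P) : p x :=
  TopLocalCohomology.induction_frac (p := p) h0 hadd hf x

end LC

/-- The algebra map `f ↦ f + ∂_ν(f) ε` to the dual numbers over `R`, determined by
`φ ↦ φ + φ(ν) ε` for linear forms `φ`. -/
noncomputable def dirDerivHom (ν : V) : SymDual k V →ₐ[k] TrivSqZeroExt (SymDual k V) (SymDual k V) :=
  SymmetricAlgebra.lift
    ((TrivSqZeroExt.inlAlgHom k (SymDual k V) (SymDual k V)).toLinearMap ∘ₗ SymmetricAlgebra.ι k _ +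
     (TrivSqZeroExt.inrHom (SymDual k V) (SymDual k V)).restrictScalars k ∘ₗ
       Algebra.linearMap k (SymDual k V) ∘ₗ Module.Dual.eval k V ν)

theorem fst_dirDerivHom (ν : V) (f : SymDual k V) : (dirDerivHom k ν f).fst = f := by
  have : (TrivSqZeroExt.fstHom k (SymDual k V) (SymDual k V)).comp (dirDerivHom k ν) =
      AlgHom.id k _ := by
    ext φ
    simp [dirDerivHom]
  exact DFunLike.congr_fun this f

/-- The directional derivative `∂_ν` on polynomial functions: the `k`-derivation of `R` with
`∂_ν(φ) = φ(ν)` for linear forms `φ`. -/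
noncomputable def dirDeriv (ν : V) : Derivation k (SymDual k V) (SymDual k V) :=
  Derivation.mk'
    ((TrivSqZeroExt.sndHom (SymDual k V) (SymDual k V)).restrictScalars k ∘ₗ
      (dirDerivHom k ν).toLinearMap) (by
    intro a b
    simp [TrivSqZeroExt.snd_mul, fst_dirDerivHom, mul_comm])

theorem dirDeriv_ι (ν : V) (φ : Module.Dual k V) :
    dirDeriv k ν (SymmetricAlgebra.ι k _ φ) = algebraMap k _ (φ ν) := by
  simp [dirDeriv, dirDerivHom, Algebra.algebraMap_eq_smul_one]

variable [FiniteDimensional k V]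

variable (V) in
/-- The coordinate functions `x₁, …, xₙ` of a chosen basis of `V`. -/
noncomputable def coordFn (i : Fin (finrank k V)) : SymDual k V :=
  SymmetricAlgebra.ι k _ ((finBasis k V).coord i)

/-- The local coordinates `zᵢ = xᵢ - Pᵢ` at `P`. -/
noncomputable def localCoord (P : V) (i : Fin (finrank k V)) : SymDual k V :=
  coordFn k V i - algebraMap k _ ((finBasis k V).coord i P)

theorem dirDeriv_localCoord (P : V) (i j) :
    dirDeriv k (finBasis k V i) (localCoord k P j) = if i = j then 1 else 0 := by
  rw [localCoord, map_sub, coordFn, dirDeriv_ι, Derivation.map_algebraMap, sub_zero,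
    Basis.coord_apply, Basis.repr_self, Finsupp.single_apply]
  split_ifs <;> simp

theorem ι_eq_sum (φ : Module.Dual k V) :
    SymmetricAlgebra.ι k _ φ = ∑ i, φ (finBasis k V i) • coordFn k V i := by
  simp only [coordFn, ← map_smul, ← map_sum]
  congr 1
  refine (finBasis k V).ext fun j => ?_
  simp

variable (V) in
/-- The components `Ω → R` of a one-form with respect to `dx₁, …, dxₙ`. -/
noncomputable def formComponents : Ω[SymDual k V⁄k] →ₗ[SymDual k V] (Fin (finrank k V) → SymDual k V) :=
  LinearMap.pi fun i => (dirDeriv k (finBasis k V i)).liftKaehlerDifferential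

variable (V) in
/-- The coefficient `f` of a top form `f dx₁ ∧ ⋯ ∧ dxₙ`. -/
noncomputable def formCoeff : TopForms k V →ₗ[SymDual k V] SymDual k V :=
  exteriorPower.alternatingMapLinearEquiv
    (Matrix.detRowAlternating.compLinearMap (formComponents k V))

/-- The top form `dz₁ ∧ ⋯ ∧ dzₙ`. -/
noncomputable def volForm (P : V) : TopForms k V :=
  exteriorPower.ιMulti (SymDual k V) (finrank k V)
    fun i => KaehlerDifferential.D k (SymDual k V) (localCoord k P i)

theorem formComponents_D (P : V) (i) :
    formComponents k V (KaehlerDifferential.D k (SymDual k V) (localCoord k P i)) =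
      Pi.single i 1 := by
  funext j
  simp [formComponents, dirDeriv_localCoord, Pi.single_apply]

theorem formCoeff_volForm (P : V) : formCoeff k V (volForm k P) = 1 := by
  rw [formCoeff, volForm, exteriorPower.alternatingMapLinearEquiv_apply_ιMulti,
    AlternatingMap.compLinearMap_apply]
  simp only [formComponents_D]
  have : (fun i => Pi.single i (1 : SymDual k V)) =
    (1 : Matrix (Fin (finrank k V)) (Fin (finrank k V)) (SymDual k V)) := by
    ext i j; simp [Matrix.one_apply, Pi.single_apply, eq_comm]
  rw [this]
  exact Matrix.det_one

theorem span_D (P : V) : ⊤ ≤ Submodule.span (SymDual k V)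
    (Set.range fun i => KaehlerDifferential.D k (SymDual k V) (localCoord k P i)) := by
  rw [← KaehlerDifferential.span_range_derivation, Submodule.span_le]
  rintro _ ⟨f, rfl⟩
  induction f using SymmetricAlgebra.induction with
  | algebraMap r => simp
  | ι φ =>
    rw [ι_eq_sum, map_sum]
    refine Submodule.sum_mem _ fun i _ => ?_
    have : coordFn k V i = localCoord k P i + algebraMap k _ ((finBasis k V).coord i P) := by
      simp [localCoord]
    rw [this, Derivation.map_smul, map_add, Derivation.map_algebraMap, add_zero,
      ← algebraMap_smul (SymDual k V)]
    exact Submodule.smul_mem _ _ (Submodule.subset_span ⟨i, rfl⟩)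
  | mul a b ha hb =>
    rw [Derivation.leibniz]
    exact Submodule.add_mem _ (Submodule.smul_mem _ _ hb) (Submodule.smul_mem _ _ ha)
  | add a b ha hb => rw [map_add]; exact Submodule.add_mem _ ha hb

theorem linInd_D (P : V) : LinearIndependent (SymDual k V)
    (fun i => KaehlerDifferential.D k (SymDual k V) (localCoord k P i)) := by
  rw [Fintype.linearIndependent_iff]
  intro g hg i
  have := congrFun (congrArg (formComponents k V) hg) i
  simpa [formComponents_D, Finset.sum_apply, Pi.single_apply] using this

theorem eq_formCoeff_smul (P : V) (ω : TopForms k V) : ω = formCoeff k V ω • volForm k P := by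
  have h : (LinearMap.id : TopForms k V →ₗ[SymDual k V] TopForms k V) =
      (LinearMap.toSpanSingleton (SymDual k V) _ (volForm k P)) ∘ₗ formCoeff k V := by
    apply exteriorPower.linearMap_ext
    refine (Basis.mk (linInd_D k P) (span_D k P)).ext_alternating fun v hv => ?_
    let σ : Equiv.Perm (Fin (finrank k V)) := Equiv.ofBijective v (Finite.injective_iff_bijective.1 hv)
    have hσ : (fun i => (Basis.mk (linInd_D k P) (span_D k P)) (v i)) =
        (fun i => KaehlerDifferential.D k (SymDual k V) (localCoord k P i)) ∘ σ := by
      funext i; simp [σ]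
    rw [hσ, AlternatingMap.map_perm, AlternatingMap.map_perm]
    congr 1
    have := formCoeff_volForm k P
    simp only [volForm] at this
    simp [LinearMap.compAlternatingMap_apply, this, volForm]
  exact LinearMap.congr_fun h ω

/-- The algebra map from `R` to the polynomial ring `k[X₁, …, Xₙ]` taking `zᵢ` to `Xᵢ`. -/
noncomputable def toMvPolyHom (P : V) : SymDual k V →ₐ[k] MvPolynomial (Fin (finrank k V)) k :=
  SymmetricAlgebra.lift
    (∑ i, (LinearMap.toSpanSingleton k (MvPolynomial (Fin (finrank k V)) k)
        (MvPolynomial.X i + MvPolynomial.C ((finBasis k V).coord i P))) ∘ₗ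
      Module.Dual.eval k V (finBasis k V i))

theorem toMvPolyHom_coordFn (P : V) (i) : toMvPolyHom k P (coordFn k V i) =
    MvPolynomial.X i + MvPolynomial.C ((finBasis k V).coord i P) := by
  rw [toMvPolyHom, coordFn, SymmetricAlgebra.lift_ι_apply, LinearMap.sum_apply,
    Finset.sum_eq_single i]
  · simp
  · intro j _ hj
    simp [hj]
  · simp

/-- The isomorphism of `R` with the polynomial ring `k[X₁, …, Xₙ]` taking `zᵢ` to `Xᵢ`. -/
noncomputable def toMvPoly (P : V) : SymDual k V ≃ₐ[k] MvPolynomial (Fin (finrank k V)) k :=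
  AlgEquiv.ofAlgHom (toMvPolyHom k P) (MvPolynomial.aeval (localCoord k P))
    (MvPolynomial.algHom_ext fun i => by
      rw [AlgHom.comp_apply, MvPolynomial.aeval_X, localCoord, map_sub, toMvPolyHom_coordFn,
        AlgHom.commutes, MvPolynomial.algebraMap_eq, add_sub_cancel_right, AlgHom.id_apply])
    (SymmetricAlgebra.algHom_ext (LinearMap.ext fun φ => by
      change MvPolynomial.aeval (localCoord k P) (toMvPolyHom k P (SymmetricAlgebra.ι k _ φ)) =
        SymmetricAlgebra.ι k _ φ
      rw [ι_eq_sum]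
      simp only [map_sum, map_smul, toMvPolyHom_coordFn, map_add, MvPolynomial.aeval_X,
        MvPolynomial.aeval_C, localCoord, sub_add_cancel]))

theorem toMvPoly_localCoord (P : V) (i) : toMvPoly k P (localCoord k P i) = MvPolynomial.X i := by
  have := (toMvPoly k P).apply_symm_apply (MvPolynomial.X i)
  simpa [toMvPoly] using this

theorem toMvPoly_symm_X (P : V) (i) : (toMvPoly k P).symm (MvPolynomial.X i) = localCoord k P i := by
  rw [AlgEquiv.symm_apply_eq, toMvPoly_localCoord]

theorem constantCoeff_toMvPoly (P : V) (f : SymDual k V) :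
    MvPolynomial.constantCoeff (toMvPoly k P f) = evalAt k P f := by
  have : (MvPolynomial.aeval (fun _ => (0 : k))).comp (toMvPolyHom k P) = evalAt k P := by
    refine SymmetricAlgebra.algHom_ext (LinearMap.ext fun φ => ?_)
    change MvPolynomial.aeval (fun _ => (0 : k)) (toMvPolyHom k P (SymmetricAlgebra.ι k _ φ)) =
      evalAt k P (SymmetricAlgebra.ι k _ φ)
    rw [ι_eq_sum]
    simp only [map_sum, map_smul, toMvPolyHom_coordFn, map_add, MvPolynomial.aeval_X,
      MvPolynomial.aeval_C, zero_add]
    simp [evalAt, coordFn]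
  rw [← this]
  change _ = MvPolynomial.aeval (fun _ => (0 : k)) (toMvPoly k P f)
  simp

theorem mem_span_localCoord (P : V) (p : ℕ) (f : SymDual k V) :
    f ∈ Ideal.span (Set.range fun i => localCoord k P i ^ p) ↔
      ∀ a, (∀ i, a i < p) → (toMvPoly k P f).coeff a = 0 := by
  have h := MvAux.mem_span_pow p Set.univ (toMvPoly k P f)
  simp only [Set.mem_univ, true_imp_iff] at h
  rw [← h]
  have h2 : Ideal.span ((fun i => (MvPolynomial.X i : MvPolynomial (Fin (finrank k V)) k) ^ p) ''
      Set.univ) = Ideal.map (toMvPoly k P).toRingEquiv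
        (Ideal.span (Set.range fun i => localCoord k P i ^ p)) := by
    rw [Ideal.map_span, Set.image_univ, ← Set.range_comp]
    congr 2
    funext i
    simp [toMvPoly_localCoord]
  rw [h2]
  constructor
  · intro hf
    exact Ideal.mem_map_of_mem (toMvPoly k P).toRingEquiv hf
  · intro hf
    obtain ⟨g, hg, hgf⟩ := (Ideal.mem_map_of_equiv (toMvPoly k P).toRingEquiv _).1 hf
    have : g = f := (toMvPoly k P).injective hgf
    rwa [← this]

theorem localCoord_mem (P : V) (i) : localCoord k P i ∈ maxIdeal k P := by
  rw [maxIdeal, RingHom.mem_ker, ← constantCoeff_toMvPoly, toMvPoly_localCoord]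
  simp

theorem maxIdeal_le_span (P : V) :
    maxIdeal k P ≤ Ideal.span (Set.range fun i => localCoord k P i ^ 1) := by
  intro f hf
  rw [maxIdeal, RingHom.mem_ker, ← constantCoeff_toMvPoly] at hf
  rw [mem_span_localCoord]
  intro a ha
  have : a = 0 := by ext i; simpa using ha i
  rw [this]
  exact hf

/-- The denominators `z₁ ^ (N + 1), …, zₙ ^ (N + 1)`. -/
noncomputable def coordSystem (P : V) (N : ℕ) : ParamSystem (maxIdeal k P) (finrank k V) where
  seq i := localCoord k P i ^ (N + 1)
  span_le := by
    rw [Ideal.span_le]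
    rintro _ ⟨i, rfl⟩
    exact Ideal.pow_mem_of_mem _ (localCoord_mem k P i) _ N.succ_pos
  pow_le := by
    have h : Ideal.span (Set.range fun i => localCoord k P i ^ 1) ≤
        (Ideal.span (Set.range fun i => localCoord k P i ^ (N + 1))).radical := by
      rw [Ideal.span_le]
      rintro _ ⟨i, rfl⟩
      exact ⟨N + 1, by
        simp only [pow_one]; exact Ideal.subset_span ⟨i, rfl⟩⟩
    obtain ⟨L, hL⟩ := Ideal.exists_pow_le_of_le_radical_of_fg h
      (Submodule.fg_span (Set.finite_range _))
    exact ⟨L, (Ideal.pow_right_mono (maxIdeal_le_span k P) L).trans hL⟩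

/-- The coefficient of `z₁ ^ N ⋯ zₙ ^ N` in a polynomial function. -/
noncomputable def diagCoeff (P : V) (N : ℕ) : SymDual k V →ₗ[k] k :=
  MvPolynomial.lcoeff k (Finsupp.equivFunOnFinite.symm fun _ => N) ∘ₗ
    (toMvPoly k P).toLinearMap

theorem diagCoeff_apply (P : V) (N : ℕ) (f : SymDual k V) : diagCoeff k P N f =
    (toMvPoly k P f).coeff (Finsupp.equivFunOnFinite.symm fun _ => N) := rfl

theorem diagCoeff_prod_mul (P : V) (N M : ℕ) (f : SymDual k V) :
    diagCoeff k P (N + M) ((∏ i, localCoord k P i ^ M) * f) = diagCoeff k P N f := by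
  rw [diagCoeff_apply, diagCoeff_apply, map_mul, map_prod]
  simp only [map_pow, toMvPoly_localCoord]
  have h1 : (∏ i, (MvPolynomial.X i : MvPolynomial (Fin (finrank k V)) k) ^ M) =
      MvPolynomial.monomial (Finsupp.equivFunOnFinite.symm fun _ => M) 1 := by
    rw [MvPolynomial.monomial_eq, Finsupp.prod_fintype _ _ (by simp)]
    simp
  have h2 : (Finsupp.equivFunOnFinite.symm fun _ : Fin (finrank k V) => N + M) =
      Finsupp.equivFunOnFinite.symm (fun _ => M) + Finsupp.equivFunOnFinite.symm fun _ => N := by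
    ext i; simp [add_comm]
  rw [h1, h2, MvPolynomial.coeff_monomial_mul, one_mul]

theorem diagCoeff_eq_zero (P : V) (N : ℕ) (f : SymDual k V)
    (hf : f ∈ Ideal.span (Set.range fun i => localCoord k P i ^ (N + 1))) :
    diagCoeff k P N f = 0 :=
  (mem_span_localCoord k P (N + 1) f).1 hf _ fun i => by simp

theorem det_sub_det_mem (P : V) (N : ℕ) (t : Fin (finrank k V) → SymDual k V)
    (A B : Matrix (Fin (finrank k V)) (Fin (finrank k V)) (SymDual k V))
    (hA : A.mulVec t = fun i => localCoord k P i ^ N)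
    (hB : B.mulVec t = fun i => localCoord k P i ^ N) :
    A.det - B.det ∈ Ideal.span (Set.range fun i => localCoord k P i ^ N) := by
  have aux : ∀ A : Matrix (Fin (finrank k V)) (Fin (finrank k V)) (SymDual k V),
      A.mulVec t = (fun i => localCoord k P i ^ N) →
      (A.map (toMvPoly k P)).mulVec (toMvPoly k P ∘ t) = fun i => MvPolynomial.X i ^ N := by
    intro A hA
    funext i
    have := congrArg (toMvPoly k P) (congrFun hA i)
    simpa [Matrix.mulVec, dotProduct, toMvPoly_localCoord] using this
  have h := MvAux.det_sub_mem N (toMvPoly k P ∘ t) _ _ (aux A hA) (aux B hB)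
  rw [MvAux.mem_span_pow] at h
  rw [mem_span_localCoord]
  intro a ha
  have h2 := h a fun i _ => ha i
  rw [map_sub, AlgEquiv.map_det, AlgEquiv.map_det]
  exact h2

theorem diagCoeff_det (P : V) (N M : ℕ) (t : Fin (finrank k V) → SymDual k V)
    (A B : Matrix (Fin (finrank k V)) (Fin (finrank k V)) (SymDual k V))
    (hA : A.mulVec t = fun i => localCoord k P i ^ (N + 1))
    (hB : B.mulVec t = fun i => localCoord k P i ^ (M + 1)) (g : SymDual k V) :
    diagCoeff k P N (A.det * g) = diagCoeff k P M (B.det * g) := by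
  have aux : ∀ (N M : ℕ) (A : Matrix (Fin (finrank k V)) (Fin (finrank k V)) (SymDual k V)),
      (A.mulVec t = fun i => localCoord k P i ^ (N + 1)) →
      (Matrix.diagonal (fun i => localCoord k P i ^ M) * A).mulVec t =
        fun i => localCoord k P i ^ (N + M + 1) := by
    intro N M A hA
    rw [← Matrix.mulVec_mulVec, hA]
    funext i
    rw [Matrix.mulVec_diagonal, ← pow_add]
    congr 1; omega
  have hA' := aux N M A hA
  have hB' := aux M N B hB
  rw [add_comm M N] at hB'
  have hd := det_sub_det_mem k P (N + M + 1) t _ _ hA' hB'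
  have h0 := diagCoeff_eq_zero k P (N + M) _ (Ideal.mul_mem_right g _ hd)
  rw [sub_mul, map_sub, sub_eq_zero, Matrix.det_mul, Matrix.det_mul, Matrix.det_diagonal,
    Matrix.det_diagonal, mul_assoc, mul_assoc, diagCoeff_prod_mul, add_comm N M,
    diagCoeff_prod_mul] at h0
  exact h0

variable {k}

theorem ParamSystem.exists_matrix {P : V} (t : ParamSystem (maxIdeal k P) (finrank k V)) :
    ∃ (N : ℕ) (A : Matrix (Fin (finrank k V)) (Fin (finrank k V)) (SymDual k V)),
      A.mulVec t.seq = fun i => localCoord k P i ^ (N + 1) := by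
  obtain ⟨N, hN⟩ := t.pow_le
  have : ∀ i, ∃ c : Fin (finrank k V) → SymDual k V,
      ∑ j, c j * t.seq j = localCoord k P i ^ (N + 1) := fun i =>
    Ideal.mem_span_range_iff_exists_fun.1
      (hN (Ideal.pow_le_pow_right N.le_succ (Ideal.pow_mem_pow (localCoord_mem k P i) _)))
  choose c hc using this
  exact ⟨N, Matrix.of c, funext hc⟩

/-- An exponent `N` and (`ParamSystem.matrix`) a matrix `A` with `A t = (z₁ ^ (N + 1), …)`. -/
noncomputable def ParamSystem.depth {P : V} (t : ParamSystem (maxIdeal k P) (finrank k V)) : ℕ :=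
  t.exists_matrix.choose

/-- A matrix `A` with `A t = (z₁ ^ (N + 1), …, zₙ ^ (N + 1))`, where `N = t.depth`. -/
noncomputable def ParamSystem.matrix {P : V} (t : ParamSystem (maxIdeal k P) (finrank k V)) :
    Matrix (Fin (finrank k V)) (Fin (finrank k V)) (SymDual k V) :=
  t.exists_matrix.choose_spec.choose

theorem ParamSystem.matrix_mulVec {P : V} (t : ParamSystem (maxIdeal k P) (finrank k V)) :
    t.matrix.mulVec t.seq = fun i => localCoord k P i ^ (t.depth + 1) :=
  t.exists_matrix.choose_spec.choose_spec

/-- The residue of the generalised fraction `[f dx₁ ∧ ⋯ ∧ dxₙ / t]`: if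
`A t = (z₁ ^ (N + 1), …, zₙ ^ (N + 1))`, it is the coefficient of `z₁ ^ N ⋯ zₙ ^ N` in `det A * f`. -/
noncomputable def fracResidue {P : V} (t : ParamSystem (maxIdeal k P) (finrank k V)) :
    TopForms k V →+ k :=
  (diagCoeff k P t.depth).toAddMonoidHom.comp
    ((AddMonoidHom.mulLeft t.matrix.det).comp (formCoeff k V).toAddMonoidHom)

theorem fracResidue_apply {P : V} (t : ParamSystem (maxIdeal k P) (finrank k V))
    (ω : TopForms k V) :
    fracResidue t ω = diagCoeff k P t.depth (t.matrix.det * formCoeff k V ω) := rfl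

theorem fracResidue_smul_seq {P : V} (t : ParamSystem (maxIdeal k P) (finrank k V)) (i)
    (ω : TopForms k V) : fracResidue t (t.seq i • ω) = 0 := by
  rw [fracResidue_apply]
  apply diagCoeff_eq_zero
  have h1 : t.matrix.adjugate.mulVec (t.matrix.mulVec t.seq) = t.matrix.det • t.seq := by
    rw [Matrix.mulVec_mulVec, Matrix.adjugate_mul, Matrix.smul_mulVec, Matrix.one_mulVec]
  have h2 : t.matrix.det * t.seq i ∈
      Ideal.span (Set.range fun i => localCoord k P i ^ (t.depth + 1)) := by
    have := congrFun h1 i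
    rw [t.matrix_mulVec] at this
    simp only [Pi.smul_apply, smul_eq_mul] at this
    rw [← this]
    change ∑ l, t.matrix.adjugate i l * localCoord k P l ^ (t.depth + 1) ∈ _
    exact Ideal.sum_mem _ fun l _ => Ideal.mul_mem_left _ _ (Ideal.subset_span ⟨l, rfl⟩)
  rw [map_smul, smul_eq_mul, ← mul_assoc]
  exact Ideal.mul_mem_right _ _ h2

theorem fracResidue_eq {P : V} (t t' : ParamSystem (maxIdeal k P) (finrank k V))
    (C : Matrix (Fin (finrank k V)) (Fin (finrank k V)) (SymDual k V))
    (h : t'.seq = C.mulVec t.seq) (ω : TopForms k V) :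
    fracResidue t ω = fracResidue t' (C.det • ω) := by
  rw [fracResidue_apply, fracResidue_apply, map_smul, smul_eq_mul, ← mul_assoc, ← Matrix.det_mul]
  refine diagCoeff_det k P _ _ t.seq _ _ t.matrix_mulVec ?_ _
  rw [← Matrix.mulVec_mulVec, ← h, t'.matrix_mulVec]

variable (k)

/-- The residue as an additive map. -/
noncomputable def residueAdd (P : V) : LC k P →+ k :=
  TopLocalCohomology.liftAdd fracResidue fracResidue_smul_seq fracResidue_eq

theorem residueAdd_frac (P : V) (t : ParamSystem (maxIdeal k P) (finrank k V)) (ω : TopForms k V)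
    (N : ℕ) (A : Matrix (Fin (finrank k V)) (Fin (finrank k V)) (SymDual k V))
    (hA : A.mulVec t.seq = fun i => localCoord k P i ^ (N + 1)) :
    residueAdd k P (LC.frac t ω) = diagCoeff k P N (A.det * formCoeff k V ω) := by
  refine (TopLocalCohomology.liftAdd_frac _ _ _ t ω).trans ?_
  exact diagCoeff_det k P _ N t.seq _ _ t.matrix_mulVec hA _

/-- The residue map `res_P : LC(V, P) → k`. -/
noncomputable def residue (P : V) : LC k P →ₗ[k] k where
  toFun := residueAdd k P
  map_add' := map_add _
  map_smul' c η := by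
    refine LC.induction_frac
      (p := fun η : LC k P => residueAdd k P (c • η) = c • residueAdd k P η) ?_ ?_ ?_ η
    · simp
    · intro x y hx hy
      rw [map_add, smul_add, smul_add, map_add, hx, hy]
    · intro t ω
      obtain ⟨N, A, hA⟩ := t.exists_matrix
      have h1 : c • (LC.frac t ω : LC k P) = LC.frac t (algebraMap k (SymDual k V) c • ω) :=
        ((LC.frac t).map_smul (algebraMap k (SymDual k V) c) ω).symm
      change residueAdd k P (c • (LC.frac t ω : LC k P)) = c • residueAdd k P (LC.frac t ω : LC k P)
      rw [h1, residueAdd_frac k P t _ N A hA, residueAdd_frac k P t _ N A hA, ← map_smul,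
        map_smul, smul_eq_mul, Algebra.smul_def]
      congr 1; ring

/-- The residue in terms of `z`-coordinates: `res_P [f dz₁ ∧ ⋯ ∧ dzₙ / z₁ ^ (N + 1), …]` is the
coefficient of `z₁ ^ N ⋯ zₙ ^ N` in `f`. -/
theorem residue_frac_coordSystem (P : V) (N : ℕ) (f : SymDual k V) :
    residue k P (LC.frac (coordSystem k P N) (f • volForm k P)) = diagCoeff k P N f := by
  refine (residueAdd_frac k P (coordSystem k P N) _ N 1 (by rw [Matrix.one_mulVec]; rfl)).trans ?_
  rw [Matrix.det_one, one_mul, map_smul, formCoeff_volForm, smul_eq_mul, mul_one]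

theorem LC.exists_rep {P : V} (η : LC k P) : ∃ N₀, ∀ N, N₀ ≤ N → ∃ f : SymDual k V,
    η = LC.frac (coordSystem k P N) (f • volForm k P) := by
  refine LC.induction_frac (p := fun η : LC k P => ∃ N₀, ∀ N, N₀ ≤ N →
    ∃ f : SymDual k V, η = LC.frac (coordSystem k P N) (f • volForm k P)) ?_ ?_ ?_ η
  · exact ⟨0, fun N _ => ⟨0, by simp⟩⟩
  · rintro x y ⟨N₁, h₁⟩ ⟨N₂, h₂⟩
    refine ⟨max N₁ N₂, fun N hN => ?_⟩
    obtain ⟨f, hf⟩ := h₁ N (by omega)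
    obtain ⟨g, hg⟩ := h₂ N (by omega)
    exact ⟨f + g, by rw [add_smul, map_add, ← hf, ← hg]⟩
  · intro t ω
    obtain ⟨N₀, A, hA⟩ := t.exists_matrix
    refine ⟨N₀, fun N hN => ?_⟩
    obtain ⟨M, rfl⟩ := Nat.exists_eq_add_of_le hN
    have h : (coordSystem k P (N₀ + M)).seq =
        (Matrix.diagonal (fun i => localCoord k P i ^ M) * A).mulVec t.seq := by
      rw [← Matrix.mulVec_mulVec, hA]
      funext i
      rw [Matrix.mulVec_diagonal, ← pow_add]
      change _ ^ (N₀ + M + 1) = _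
      congr 1; omega
    refine ⟨(Matrix.diagonal (fun i => localCoord k P i ^ M) * A).det * formCoeff k V ω, ?_⟩
    refine (LC.frac_eq _ _ _ h ω).trans (congrArg _ ?_)
    rw [mul_smul]
    exact congrArg (fun x => (Matrix.diagonal (fun i => localCoord k P i ^ M) * A).det • x)
      (eq_formCoeff_smul k P ω)

theorem LC.exists_pow_smul_eq_zero {P : V} (η : LC k P) :
    ∃ N, ∀ f ∈ maxIdeal k P ^ N, f • η = 0 := by
  obtain ⟨N, hN⟩ := LC.exists_rep k η
  obtain ⟨g, rfl⟩ := hN N le_rfl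
  obtain ⟨L, hL⟩ := (coordSystem k P N).pow_le
  refine ⟨L, fun f hf => ?_⟩
  obtain ⟨c, rfl⟩ := Ideal.mem_span_range_iff_exists_fun.1 (hL hf)
  rw [Finset.sum_smul]
  refine Finset.sum_eq_zero fun j _ => ?_
  rw [mul_smul, ← map_smul]
  have : LC.frac (coordSystem k P N) ((coordSystem k P N).seq j • g • volForm k P) = 0 :=
    LC.frac_smul_seq _ _ _
  rw [this, smul_zero]

/-- The continuous functionals at `P`: linear maps `μ : R → k` vanishing on a power of `m_P`.
This is `Hom^cont(R_{m_P}, k) = colim Hom(R / m_P ^ i, k)`. -/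
def ContDual (P : V) : Submodule k (Module.Dual k (SymDual k V)) where
  carrier := {μ | ∃ N, ∀ f ∈ maxIdeal k P ^ N, μ f = 0}
  zero_mem' := ⟨0, by simp⟩
  add_mem' := by
    rintro μ μ' ⟨N, hN⟩ ⟨M, hM⟩
    refine ⟨max N M, fun f hf => ?_⟩
    rw [LinearMap.add_apply, hN f (Ideal.pow_le_pow_right (le_max_left _ _) hf),
      hM f (Ideal.pow_le_pow_right (le_max_right _ _) hf), add_zero]
  smul_mem' := by
    rintro c μ ⟨N, hN⟩
    exact ⟨N, fun f hf => by rw [LinearMap.smul_apply, hN f hf, smul_zero]⟩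

/-- The map `η ↦ res_P((-) η)` from local cohomology to continuous functionals. -/
noncomputable def toContDual (P : V) : LC k P →ₗ[k] ContDual k P where
  toFun η := ⟨{ toFun := fun f => residue k P (f • η)
                map_add' := fun f g => by rw [add_smul, map_add]
                map_smul' := fun c f => by rw [smul_assoc, map_smul, RingHom.id_apply] }, by
    obtain ⟨N, hN⟩ := LC.exists_pow_smul_eq_zero k η
    exact ⟨N, fun f hf => by simp [hN f hf]⟩⟩
  map_add' η η' := by
    ext f; simp
  map_smul' c η := by
    ext f; simp [smul_comm f c η]

theorem toContDual_apply (P : V) (η : LC k P) (f : SymDual k V) :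
    (toContDual k P η : Module.Dual k (SymDual k V)) f = residue k P (f • η) := rfl

theorem mul_localCoord_coeff (P : V) (N : ℕ) (a : Fin (finrank k V) →₀ ℕ) (ha : ∀ i, a i < N + 1)
    (f : SymDual k V) :
    diagCoeff k P N ((∏ i, localCoord k P i ^ (N - a i)) * f) = (toMvPoly k P f).coeff a := by
  rw [diagCoeff_apply, map_mul, map_prod]
  simp only [map_pow, toMvPoly_localCoord]
  have h1 : (∏ i, (MvPolynomial.X i : MvPolynomial (Fin (finrank k V)) k) ^ (N - a i)) =
      MvPolynomial.monomial (Finsupp.equivFunOnFinite.symm fun i => N - a i) 1 := by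
    rw [MvPolynomial.monomial_eq, Finsupp.prod_fintype _ _ (by simp)]
    simp
  have h2 : (Finsupp.equivFunOnFinite.symm fun _ : Fin (finrank k V) => N) =
      Finsupp.equivFunOnFinite.symm (fun i => N - a i) + a := by
    ext i
    have := ha i
    simp; omega
  rw [h1, h2, MvPolynomial.coeff_monomial_mul, one_mul]

theorem residue_mul_frac (P : V) (N : ℕ) (f g : SymDual k V) :
    residue k P (g • (LC.frac (coordSystem k P N) (f • volForm k P) : LC k P)) =
      diagCoeff k P N (f * g) := by
  rw [← map_smul, ← mul_smul, residue_frac_coordSystem, mul_comm]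

theorem toContDual_injective (P : V) : Function.Injective (toContDual k P) := by
  refine (injective_iff_map_eq_zero _).2 fun η hη => ?_
  obtain ⟨N, hN⟩ := LC.exists_rep k η
  obtain ⟨f, rfl⟩ := hN N le_rfl
  have hf : f ∈ Ideal.span (Set.range fun i => localCoord k P i ^ (N + 1)) := by
    rw [mem_span_localCoord]
    intro a ha
    rw [← mul_localCoord_coeff k P N a ha, mul_comm, ← residue_mul_frac, ← toContDual_apply, hη]
    rfl
  obtain ⟨c, rfl⟩ := Ideal.mem_span_range_iff_exists_fun.1 hf
  rw [Finset.sum_smul, map_sum]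
  refine Finset.sum_eq_zero fun j _ => ?_
  rw [mul_comm, mul_smul]
  exact LC.frac_smul_seq (coordSystem k P N) j _

/-- The exponents `a` with `aᵢ ≤ N` for all `i`. -/
noncomputable def boxExponents (n N : ℕ) : Finset (Fin n →₀ ℕ) :=
  Finset.Iic (Finsupp.equivFunOnFinite.symm fun _ => N)

theorem mem_boxExponents {n N : ℕ} {a : Fin n →₀ ℕ} : a ∈ boxExponents n N ↔ ∀ i, a i < N + 1 := by
  simp [boxExponents, Finsupp.le_def]

/-- The monomials `z ^ a`. -/
noncomputable def coordMonomial (P : V) (a : Fin (finrank k V) →₀ ℕ) : SymDual k V :=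
  ∏ i, localCoord k P i ^ a i

theorem toMvPoly_coordMonomial (P : V) (a) :
    toMvPoly k P (coordMonomial k P a) = MvPolynomial.monomial a 1 := by
  rw [coordMonomial, map_prod, MvPolynomial.monomial_eq, Finsupp.prod_fintype _ _ (by simp)]
  simp [toMvPoly_localCoord]

theorem apply_eq_sum (P : V) (μ : Module.Dual k (SymDual k V)) (N : ℕ)
    (hμ : ∀ f ∈ maxIdeal k P ^ (N + 1), μ f = 0) (f : SymDual k V) :
    μ f = ∑ a ∈ boxExponents (finrank k V) N,
      (toMvPoly k P f).coeff a * μ (coordMonomial k P a) := by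
  have h : f - ∑ a ∈ boxExponents (finrank k V) N, (toMvPoly k P f).coeff a • coordMonomial k P a ∈
      maxIdeal k P ^ (N + 1) := by
    have hle : Ideal.span (Set.range fun i => localCoord k P i ^ (N + 1)) ≤
        maxIdeal k P ^ (N + 1) := by
      rw [Ideal.span_le]
      rintro _ ⟨i, rfl⟩
      exact Ideal.pow_mem_pow (localCoord_mem k P i) _
    apply hle
    rw [mem_span_localCoord]
    intro a ha
    simp only [map_sub, map_sum, map_smul, toMvPoly_coordMonomial, MvPolynomial.coeff_sub,
      MvPolynomial.coeff_sum, MvPolynomial.coeff_smul, MvPolynomial.coeff_monomial]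
    rw [Finset.sum_eq_single a]
    · simp
    · intro b _ hb; simp [hb]
    · intro h; exact absurd (mem_boxExponents.2 ha) h
  have := hμ _ h
  rw [map_sub, sub_eq_zero, map_sum] at this
  rw [this]
  simp

theorem toContDual_surjective (P : V) : Function.Surjective (toContDual k P) := by
  rintro ⟨μ, N, hN⟩
  have hN' : ∀ f ∈ maxIdeal k P ^ (N + 1), μ f = 0 := fun f hf =>
    hN f (Ideal.pow_le_pow_right N.le_succ hf)
  refine ⟨LC.frac (coordSystem k P N)
    ((∑ a ∈ boxExponents (finrank k V) N,
      μ (coordMonomial k P a) • ∏ i, localCoord k P i ^ (N - a i)) • volForm k P), ?_⟩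
  ext f
  rw [toContDual_apply, residue_mul_frac, apply_eq_sum k P μ N hN', Finset.sum_mul, map_sum]
  refine Finset.sum_congr rfl fun a ha => ?_
  rw [smul_mul_assoc, map_smul, mul_localCoord_coeff k P N a (mem_boxExponents.1 ha), smul_eq_mul,
    mul_comm]

/-- Local duality: the isomorphism `LC(V, P) ≃ Hom^cont(R_{m_P}, k)`, `η ↦ res_P((-) η)`. -/
noncomputable def localDuality (P : V) : LC k P ≃ₗ[k] ContDual k P :=
  LinearEquiv.ofBijective (toContDual k P) ⟨toContDual_injective k P, toContDual_surjective k P⟩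

/-- The pairing `⟨f, η⟩ = res_P(f η)` of polynomial functions with local cohomology. -/
noncomputable def resPairing (P : V) : SymDual k V →ₗ[k] LC k P →ₗ[k] k :=
  ((ContDual k P).subtype ∘ₗ toContDual k P).flip

theorem resPairing_apply (P : V) (f : SymDual k V) (η : LC k P) :
    resPairing k P f η = residue k P (f • η) := rfl

theorem resPairing_separating (P : V) (η : LC k P) (h : ∀ f, resPairing k P f η = 0) : η = 0 := by
  apply toContDual_injective k P
  rw [map_zero]
  ext f
  exact h f

section TensorPairing

variable {k} {M N : Type*} [AddCommGroup M] [Module k M] [AddCommGroup N] [Module k N]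

/-- The functional `x ⊗ y ↦ p x * q y`. -/
noncomputable def tensorFunctional (p : M →ₗ[k] k) (q : N →ₗ[k] k) : M ⊗[k] N →ₗ[k] k :=
  LinearMap.mul' k k ∘ₗ TensorProduct.map p q

@[simp] theorem tensorFunctional_tmul (p : M →ₗ[k] k) (q : N →ₗ[k] k) (x : M) (y : N) :
    tensorFunctional p q (x ⊗ₜ y) = p x * q y := by
  simp [tensorFunctional]

theorem tensorFunctional_separating {X Y : Type*} (p : X → M →ₗ[k] k) (q : Y → N →ₗ[k] k)
    (hp : ∀ m, (∀ x, p x m = 0) → m = 0) (hq : ∀ n, (∀ y, q y n = 0) → n = 0)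
    (ξ : M ⊗[k] N) (h : ∀ x y, tensorFunctional (p x) (q y) ξ = 0) : ξ = 0 := by
  classical
  let b := Module.Basis.ofVectorSpace k M
  have key : ∀ y (ξ : M ⊗[k] N), TensorProduct.rid k M (TensorProduct.map LinearMap.id (q y) ξ) =
      (TensorProduct.equivFinsuppOfBasisLeft b ξ).sum fun i n => q y n • b i := by
    intro y ξ
    induction ξ with
    | zero => simp
    | add a c ha hc =>
      rw [map_add, map_add, map_add, ha, hc, Finsupp.sum_add_index']
      · simp
      · intros; rw [map_add, add_smul]
    | tmul m n =>
      rw [TensorProduct.equivFinsuppOfBasisLeft_apply_tmul, Finsupp.sum_mapRange_index (by simp)]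
      simp only [TensorProduct.map_tmul, LinearMap.id_apply, TensorProduct.rid_tmul, map_smul,
        smul_eq_mul]
      conv_lhs => rw [← b.linearCombination_repr m, Finsupp.linearCombination_apply,
        Finsupp.smul_sum]
      simp [smul_smul, mul_comm]
  have h1 : ∀ y, TensorProduct.rid k M (TensorProduct.map LinearMap.id (q y) ξ) = 0 := by
    intro y
    refine hp _ fun x => ?_
    rw [← h x y]
    have : ∀ ξ : M ⊗[k] N, p x (TensorProduct.rid k M (TensorProduct.map LinearMap.id (q y) ξ)) =
        tensorFunctional (p x) (q y) ξ := by
      intro ξ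
      induction ξ with
      | zero => simp
      | add a c ha hc => simp only [map_add, ha, hc]
      | tmul m n => simp [mul_comm]
    exact this ξ
  apply (TensorProduct.equivFinsuppOfBasisLeft (N := N) b).injective
  rw [map_zero]
  ext i
  refine hq _ fun y => ?_
  have h2 := h1 y
  rw [key] at h2
  have h3 := congrArg (fun m => b.repr m i) h2
  simp only [Finsupp.sum, map_sum, map_smul, Basis.repr_self, Finsupp.coe_finsetSum,
    Finset.sum_apply, Finsupp.smul_single, Finsupp.single_apply, map_zero, Finsupp.coe_zero,
    Pi.zero_apply, smul_eq_mul, mul_one, Finset.sum_ite_eq', Finsupp.mem_support_iff] at h3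
  by_cases hz : TensorProduct.equivFinsuppOfBasisLeft b ξ i = 0
  · rw [hz, map_zero]
  · simpa [hz] using h3

end TensorPairing

/-- The functional `⟨f ⊗ g, -⟩` on `LC(V, P) ⊗ LC(V, P)`. -/
noncomputable def resPairing₂ (P : V) (f g : SymDual k V) : LC k P ⊗[k] LC k P →ₗ[k] k :=
  tensorFunctional (resPairing k P f) (resPairing k P g)

theorem resPairing₂_separating (P : V) (ξ ξ' : LC k P ⊗[k] LC k P)
    (h : ∀ f g, resPairing₂ k P f g ξ = resPairing₂ k P f g ξ') : ξ = ξ' := by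
  rw [← sub_eq_zero]
  refine tensorFunctional_separating (resPairing k P) (resPairing k P)
    (resPairing_separating k P) (resPairing_separating k P) _ fun f g => ?_
  rw [map_sub, sub_eq_zero]
  exact h f g

theorem coeff_mem_contDual (P : V) (a : Fin (finrank k V) →₀ ℕ) :
    MvPolynomial.lcoeff k a ∘ₗ (toMvPoly k P).toLinearMap ∈ ContDual k P := by
  obtain ⟨L, hL⟩ := (coordSystem k P (∑ i, a i)).pow_le
  refine ⟨L, fun f hf => ?_⟩
  exact (mem_span_localCoord k P _ f).1 (hL hf) a fun i =>
    Nat.lt_succ_of_le (Finset.single_le_sum (f := fun i => a i) (fun _ _ => Nat.zero_le _)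
      (Finset.mem_univ i))

/-- The element of `LC(V, P)` dual to the monomial `z ^ a`. -/
noncomputable def dualMonomial (P : V) (a : Fin (finrank k V) →₀ ℕ) : LC k P :=
  (localDuality k P).symm ⟨_, coeff_mem_contDual k P a⟩

theorem resPairing_dualMonomial (P : V) (a) (f : SymDual k V) :
    resPairing k P f (dualMonomial k P a) = (toMvPoly k P f).coeff a := by
  have h := (localDuality k P).apply_symm_apply ⟨_, coeff_mem_contDual k P a⟩
  exact LinearMap.congr_fun (congrArg Subtype.val h) f

/-- The coproduct dual to the multiplication of `R` exists. -/
theorem exists_comul (P : V) (η : LC k P) : ∃ ξ : LC k P ⊗[k] LC k P,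
    ∀ f g, resPairing₂ k P f g ξ = resPairing k P (f * g) η := by
  obtain ⟨N, hN⟩ := LC.exists_pow_smul_eq_zero k η
  have hN' : ∀ f ∈ maxIdeal k P ^ (N + 1), resPairing k P f η = 0 := fun f hf => by
    rw [resPairing_apply, hN f (Ideal.pow_le_pow_right N.le_succ hf), map_zero]
  refine ⟨∑ a ∈ boxExponents (finrank k V) N, ∑ b ∈ boxExponents (finrank k V) N,
    resPairing k P (coordMonomial k P a * coordMonomial k P b) η •
      (dualMonomial k P a ⊗ₜ dualMonomial k P b), fun f g => ?_⟩
  have h1 := apply_eq_sum k P ((resPairing k P).flip η ∘ₗ LinearMap.mulRight k g) N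
    (fun f hf => hN' _ (Ideal.mul_mem_right _ _ hf)) f
  have h2 := fun a => apply_eq_sum k P
    ((resPairing k P).flip η ∘ₗ LinearMap.mulLeft k (coordMonomial k P a)) N
    (fun f hf => hN' _ (Ideal.mul_mem_left _ _ hf)) g
  simp only [LinearMap.comp_apply, LinearMap.mulRight_apply, LinearMap.mulLeft_apply,
    LinearMap.flip_apply] at h1 h2
  rw [h1]
  simp only [map_sum, map_smul]
  refine Finset.sum_congr rfl fun a _ => ?_
  rw [h2, Finset.mul_sum]
  refine Finset.sum_congr rfl fun b _ => ?_
  rw [resPairing₂, tensorFunctional_tmul, resPairing_dualMonomial, resPairing_dualMonomial,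
    smul_eq_mul]
  ring

/-- The coproduct of `LC(V, P)`, dual to the multiplication of `R`: the unique map with
`⟨f ⊗ g, Δ η⟩ = ⟨f g, η⟩` for all polynomial functions `f, g`. -/
noncomputable def LC.comul (P : V) : LC k P →ₗ[k] LC k P ⊗[k] LC k P where
  toFun η := (exists_comul k P η).choose
  map_add' η η' := resPairing₂_separating k P _ _ fun f g => by
    rw [map_add, (exists_comul k P _).choose_spec, (exists_comul k P _).choose_spec,
      (exists_comul k P _).choose_spec, map_add]
  map_smul' c η := resPairing₂_separating k P _ _ fun f g => by
    rw [map_smul, (exists_comul k P _).choose_spec, (exists_comul k P _).choose_spec, map_smul,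
      RingHom.id_apply]

theorem resPairing₂_comul (P : V) (f g : SymDual k V) (η : LC k P) :
    resPairing₂ k P f g (LC.comul k P η) = resPairing k P (f * g) η :=
  (exists_comul k P η).choose_spec f g

/-- `LC(V, P)` is a coalgebra: the coproduct is dual to multiplication in `R`, the counit is the
residue. -/
noncomputable instance LC.instCoalgebra (P : V) : Coalgebra k (LC k P) where
  comul := LC.comul k P
  counit := residue k P
  coassoc := by
    ext η
    rw [← sub_eq_zero]
    refine tensorFunctional_separating (resPairing k P)
      (fun x : SymDual k V × SymDual k V => resPairing₂ k P x.1 x.2) (resPairing_separating k P)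
      (fun ξ hξ => resPairing₂_separating k P _ _ fun f g => by
        rw [map_zero]; exact hξ (f, g)) _ fun f x => ?_
    have h1 : ∀ (ξ : LC k P ⊗[k] LC k P) (y : LC k P),
        tensorFunctional (resPairing k P f) (resPairing₂ k P x.1 x.2)
          (TensorProduct.assoc k _ _ _ (ξ ⊗ₜ y)) =
        resPairing₂ k P f x.1 ξ * resPairing k P x.2 y := by
      intro ξ y
      induction ξ with
      | zero => simp
      | add a c ha hc => rw [TensorProduct.add_tmul, map_add, map_add, ha, hc, map_add, add_mul]
      | tmul a c => simp [resPairing₂, mul_assoc]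
    have h2 : ∀ ξ : LC k P ⊗[k] LC k P,
        tensorFunctional (resPairing k P f) (resPairing₂ k P x.1 x.2)
          (TensorProduct.assoc k _ _ _ ((LC.comul k P).rTensor _ ξ)) =
        resPairing₂ k P (f * x.1) x.2 ξ := by
      intro ξ
      induction ξ with
      | zero => simp
      | add a c ha hc => simp only [map_add, ha, hc]
      | tmul a c =>
        rw [LinearMap.rTensor_tmul, h1, resPairing₂_comul, resPairing₂, tensorFunctional_tmul]
    have h3 : ∀ ξ : LC k P ⊗[k] LC k P,
        tensorFunctional (resPairing k P f) (resPairing₂ k P x.1 x.2)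
          ((LC.comul k P).lTensor _ ξ) = resPairing₂ k P f (x.1 * x.2) ξ := by
      intro ξ
      induction ξ with
      | zero => simp
      | add a c ha hc => simp only [map_add, ha, hc]
      | tmul a c =>
        rw [LinearMap.lTensor_tmul, tensorFunctional_tmul, resPairing₂_comul, resPairing₂,
          tensorFunctional_tmul]
    rw [map_sub, sub_eq_zero]
    simp only [LinearMap.comp_apply, LinearEquiv.coe_coe]
    rw [h2, h3, resPairing₂_comul, resPairing₂_comul, mul_assoc]
  rTensor_counit_comp_comul := by
    ext η
    apply (TensorProduct.lid k (LC k P)).injective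
    rw [← sub_eq_zero]
    refine resPairing_separating k P _ fun g => ?_
    have h : ∀ ξ : LC k P ⊗[k] LC k P,
        resPairing k P g (TensorProduct.lid k _ ((residue k P).rTensor _ ξ)) =
          resPairing₂ k P 1 g ξ := by
      intro ξ
      induction ξ with
      | zero => simp
      | add a c ha hc => simp only [map_add, ha, hc]
      | tmul a c => simp [resPairing₂, resPairing_apply]
    rw [map_sub, sub_eq_zero, LinearMap.comp_apply, h, resPairing₂_comul, one_mul]
    simp
  lTensor_counit_comp_comul := by
    ext η
    apply (TensorProduct.rid k (LC k P)).injective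
    rw [← sub_eq_zero]
    refine resPairing_separating k P _ fun g => ?_
    have h : ∀ ξ : LC k P ⊗[k] LC k P,
        resPairing k P g (TensorProduct.rid k _ ((residue k P).lTensor _ ξ)) =
          resPairing₂ k P g 1 ξ := by
      intro ξ
      induction ξ with
      | zero => simp
      | add a c ha hc => simp only [map_add, ha, hc]
      | tmul a c => simp [resPairing₂, resPairing_apply, mul_comm]
    rw [map_sub, sub_eq_zero, LinearMap.comp_apply, h, resPairing₂_comul, mul_one]
    simp

instance LC.instIsCocomm (P : V) : Coalgebra.IsCocomm k (LC k P) where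
  comm_comp_comul := by
    ext η
    refine resPairing₂_separating k P _ _ fun f g => ?_
    have h : ∀ ξ : LC k P ⊗[k] LC k P,
        resPairing₂ k P f g (TensorProduct.comm k _ _ ξ) = resPairing₂ k P g f ξ := by
      intro ξ
      induction ξ with
      | zero => simp
      | add a c ha hc => simp only [map_add, ha, hc]
      | tmul a c => simp [resPairing₂, mul_comm]
    change resPairing₂ k P f g (TensorProduct.comm k _ _ (LC.comul k P η)) =
      resPairing₂ k P f g (LC.comul k P η)
    rw [h, resPairing₂_comul, resPairing₂_comul, mul_comm]

theorem dirDeriv_mem_pow (P ν : V) (N : ℕ) :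
    ∀ f ∈ maxIdeal k P ^ (N + 1), dirDeriv k ν f ∈ maxIdeal k P ^ N := by
  induction N with
  | zero => intro f _; simp
  | succ N ih =>
    intro f hf
    rw [pow_succ] at hf
    refine Submodule.mul_induction_on hf ?_ ?_
    · intro a ha b hb
      rw [Derivation.leibniz, smul_eq_mul, smul_eq_mul]
      refine Ideal.add_mem _ (Ideal.mul_mem_right _ _ ha) ?_
      rw [pow_succ, mul_comm b]
      exact Ideal.mul_mem_mul (ih a ha) hb
    · intro a b ha hb
      rw [map_add]
      exact Ideal.add_mem _ ha hb

/-- The right action of `∂_ν` on continuous functionals: `μ ↦ μ ∘ ∂_ν`. -/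
noncomputable def ContDual.precompDeriv (P ν : V) : ContDual k P →ₗ[k] ContDual k P :=
  LinearMap.restrict (LinearMap.lcomp k k (dirDeriv k ν : SymDual k V →ₗ[k] SymDual k V)) (by
    rintro μ ⟨N, hN⟩
    exact ⟨N + 1, fun f hf => hN _ (dirDeriv_mem_pow k P ν N f hf)⟩)

/-- The action of `∂_ν` on `LC(V, P)`, through local duality: `res_P(f (∂_ν η)) = res_P(∂_ν(f) η)`. -/
noncomputable def LC.deriv (P ν : V) : LC k P →ₗ[k] LC k P :=
  (localDuality k P).symm.toLinearMap ∘ₗ ContDual.precompDeriv k P ν ∘ₗ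
    (localDuality k P).toLinearMap

theorem residue_smul_deriv (P ν : V) (f : SymDual k V) (η : LC k P) :
    residue k P (f • LC.deriv k P ν η) = residue k P (dirDeriv k ν f • η) := by
  have h := (localDuality k P).apply_symm_apply
    (ContDual.precompDeriv k P ν (localDuality k P η))
  exact LinearMap.congr_fun (congrArg Subtype.val h) f

/-- The vacuum `|0⟩_P = [dz₁ ∧ ⋯ ∧ dzₙ / z₁, …, zₙ]`. -/
noncomputable def vacuum (P : V) : LC k P := LC.frac (coordSystem k P 0) (volForm k P)

/-- The ket `|ν₁, …, νₛ⟩_P = ∂_{ν₁} ⋯ ∂_{νₛ} |0⟩_P`. -/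
noncomputable def ket (P : V) (l : List V) : LC k P :=
  l.foldr (fun ν η => LC.deriv k P ν η) (vacuum k P)

variable (V) in
/-- The coalgebra `!V = ⨁_P LC(V, P)`. -/
abbrev Bang := Π₀ P : V, LC k P

/-- The map `d_P : LC(V, P) → V ≅ V**`, `d_P(η)(φ) = res_P(φ η)` for `φ ∈ V* ⊆ R`. -/
noncomputable def derelictionAt (P : V) : LC k P →ₗ[k] V :=
  (Module.evalEquiv k V).symm.toLinearMap ∘ₗ
    LinearMap.lcomp k k (SymmetricAlgebra.ι k (Module.Dual k V)) ∘ₗ (resPairing k P).flip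

variable (V) in
/-- The dereliction `d = ∑_P d_P : !V → V`. -/
noncomputable def dereliction [DecidableEq V] : Bang k V →ₗ[k] V :=
  DFinsupp.lsum k fun P => derelictionAt k P

end SymDual

section Sym

variable (k : Type*) {V : Type*} [Field k] [AddCommGroup V] [Module k V]

variable (V) in
/-- The degree one component `Sym(V) → V`, `(v₀, v₁, v₂, …) ↦ v₁`: the projection of `Sym(V)` onto
`Sym(V) / (V²) = k ⊕ V`, followed by the projection onto `V`. -/
noncomputable def symDegOne : SymmetricAlgebra k V →ₗ[k] V :=
  letI : Module kᵐᵒᵖ V := Module.compHom V ((RingHom.id k).fromOpposite mul_comm)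
  haveI : IsCentralScalar k V := ⟨fun _ _ => rfl⟩
  TrivSqZeroExt.sndHom k V ∘ₗ
    (SymmetricAlgebra.lift (TrivSqZeroExt.inrHom k V) :
      SymmetricAlgebra k V →ₐ[k] TrivSqZeroExt k V).toLinearMap

theorem symDegOne_algebraMap (c : k) : symDegOne k V (algebraMap k _ c) = 0 := by
  simp [symDegOne, TrivSqZeroExt.algebraMap_eq_inl]

theorem symDegOne_ι (v : V) : symDegOne k V (SymmetricAlgebra.ι k V v) = v := by
  simp [symDegOne]

theorem symDegOne_ι_mul_ι_mul (v w : V) (x : SymmetricAlgebra k V) :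
    symDegOne k V (SymmetricAlgebra.ι k V v * SymmetricAlgebra.ι k V w * x) = 0 := by
  simp [symDegOne]

/-- The map `c_P : Sym_P(V) → V`, `(v₀, v₁, v₂, …) ↦ v₀ P + v₁`. -/
noncomputable def symToV (P : V) : SymmetricAlgebra k V →ₗ[k] V :=
  LinearMap.toSpanSingleton k V P ∘ₗ SymmetricAlgebra.algebraMapInv.toLinearMap + symDegOne k V

end Sym

end CofreeCoalgebra

/-! Fix a point $P$. Local duality makes the pairing $\langle
f,\eta\rangle=\operatorname{res}_P(f\eta)$ separate the elements of $\mathrm{LC}(V,P)$, so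
identities there are checked against polynomial functions. Under it the vacuum is evaluation at $P$
(`resPairing_vacuum`) and $\partial_\nu$ is the transpose of the directional derivative. Functionals
killing a power of $\mathfrak m_P$ have a basis dual to the monomials $z^a$, on which $\partial_i$
acts as a raising operator with factor $a_i+1$ (`deriv_dualMonomial`). Sending $e^a$ to $a!$ times
the element dual to $z^a$ absorbs these factors. In characteristic zero this is a linear isomorphism
$\operatorname{Sym}(V)\to\mathrm{LC}(V,P)$.

This map takes $1$ to the vacuum and turns multiplication by $v$ into $\partial_v$
(`symEquivLC_one`, `symEquivLC_ι_mul`). Those two properties no longer mention the basis and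
determine the map; this is the sense in which it is canonical. They give the formula on kets at
once. Induction on multiplication by one vector gives the rest: the residue kills derivatives
because $\partial_v 1=0$ (`residue_symEquivLC`); the coproducts agree because primitivity of $v$ is
dual to the Leibniz rule (`comul_symEquivLC`); and the dereliction is $c_P$ because
$\partial_v\varphi=\varphi(v)$ is constant (`derelictionAt_symEquivLC`). The inverse isomorphisms
are then summed over $P$. -/

namespace CofreeCoalgebra

open scoped TensorProduct
open Module Coalgebra

/-! ### Symmetric algebras: the maps $c_P$ and directional derivatives -/

section SymmetricAlgebraFacts

variable {k V : Type*} [Field k] [AddCommGroup V] [Module k V]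

/-- Induction on the symmetric algebra by multiplication with one vector at a time. -/
theorem symmetricAlgebra_induction_left {p : SymmetricAlgebra k V → Prop}
    (one : p 1) (smul : ∀ (c : k) x, p x → p (c • x)) (add : ∀ x y, p x → p y → p (x + y))
    (ι_mul : ∀ v x, p x → p (SymmetricAlgebra.ι k V v * x)) (x : SymmetricAlgebra k V) : p x := by
  suffices h : ∀ y, p y → p (x * y) by simpa using h 1 one
  induction x using SymmetricAlgebra.induction with
  | algebraMap r => intro y hy; rw [← Algebra.smul_def]; exact smul r y hy
  | ι v => exact ι_mul v
  | mul a b ha hb => intro y hy; rw [mul_assoc]; exact ha _ (hb y hy)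
  | add a b ha hb => intro y hy; rw [add_mul]; exact add _ _ (ha y hy) (hb y hy)

theorem counit_ι_mul (v : V) (x : SymmetricAlgebra k V) :
    counit (R := k) (SymmetricAlgebra.ι k V v * x) = 0 := by
  rw [Bialgebra.counit_mul, SymmetricAlgebra.counit_ι, zero_mul]

/-- A product of two or more vectors has no component of degree one, so only the constant term of
`x`, which is its counit, contributes. -/
theorem symDegOne_ι_mul (v : V) (x : SymmetricAlgebra k V) :
    symDegOne k V (SymmetricAlgebra.ι k V v * x) = counit (R := k) x • v := by
  induction x using symmetricAlgebra_induction_left with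
  | one => rw [mul_one, symDegOne_ι, Bialgebra.counit_one, one_smul]
  | smul c x hx => rw [mul_smul_comm, map_smul, map_smul, hx, smul_assoc]
  | add x y hx hy => rw [mul_add, map_add, map_add, hx, hy, add_smul]
  | ι_mul w x _ => rw [← mul_assoc, symDegOne_ι_mul_ι_mul, counit_ι_mul, zero_smul]

theorem symToV_one (P : V) : symToV k P 1 = P := by
  have h := symDegOne_algebraMap k (V := V) 1
  rw [map_one] at h
  simp [symToV, h]

/-- The product has no constant term, so the point $P$ drops out. With `symToV_one` this is the
recursion that the dereliction will be shown to satisfy as well. -/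
theorem symToV_ι_mul (P v : V) (x : SymmetricAlgebra k V) :
    symToV k P (SymmetricAlgebra.ι k V v * x) = counit (R := k) x • v := by
  simp [symToV, symDegOne_ι_mul, SymmetricAlgebra.algebraMapInv_ι]

/-- Both sides obey the Leibniz rule in `f`, so it is enough that they agree on linear forms, where
$\varphi\mapsto\varphi(v)$ is visibly additive in $v$. -/
theorem dirDeriv_add (v w : V) (f : SymDual k V) :
    dirDeriv k (v + w) f = dirDeriv k v f + dirDeriv k w f := by
  induction f using SymmetricAlgebra.induction with
  | algebraMap r => simp
  | ι φ => simp [dirDeriv_ι]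
  | mul a b ha hb => simp only [Derivation.leibniz, ha, hb, smul_add]; abel
  | add a b ha hb => simp only [map_add, ha, hb]; abel

theorem dirDeriv_smul (c : k) (v : V) (f : SymDual k V) :
    dirDeriv k (c • v) f = c • dirDeriv k v f := by
  induction f using SymmetricAlgebra.induction with
  | algebraMap r => simp
  | ι φ => simp [dirDeriv_ι, Algebra.smul_def]
  | mul a b ha hb => simp only [Derivation.leibniz, ha, hb, smul_add, smul_comm c]
  | add a b ha hb => simp only [map_add, ha, hb, smul_add]

end SymmetricAlgebraFacts

/-! ### The residue pairing and the basis dual to monomials -/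

section Duality

variable {k V : Type*} [Field k] [AddCommGroup V] [Module k V] [FiniteDimensional k V]

theorem resPairing_one (P : V) (η : LC k P) : resPairing k P 1 η = residue k P η := by
  rw [resPairing_apply, one_smul]

theorem resPairing_deriv (P ν : V) (f : SymDual k V) (η : LC k P) :
    resPairing k P f (LC.deriv k P ν η) = resPairing k P (dirDeriv k ν f) η :=
  residue_smul_deriv k P ν f η

theorem LC.ext_resPairing {P : V} {η η' : LC k P}
    (h : ∀ f, resPairing k P f η = resPairing k P f η') : η = η' := by
  rw [← sub_eq_zero]
  refine resPairing_separating k P _ fun f => ?_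
  rw [map_sub, h, sub_self]

/-- With denominators $z_1,\ldots,z_n$ the residue reads off the constant coefficient in the local
coordinates, which is the value at $P$. -/
theorem resPairing_vacuum (P : V) (f : SymDual k V) :
    resPairing k P f (vacuum k P) = evalAt k P f := by
  rw [← constantCoeff_toMvPoly, resPairing_apply, vacuum]
  -- The denominators of `coordSystem k P 0` are $z_i^{0+1}$, so the vacuum is the case of depth `0`
  -- and numerator `1`.
  have h := residue_mul_frac k P 0 1 f
  rw [one_smul, one_mul] at h
  rw [h, diagCoeff_apply, MvPolynomial.constantCoeff_eq]
  exact congrArg (MvPolynomial.coeff · _) (by ext; simp)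

theorem dualMonomial_zero (P : V) : dualMonomial k P 0 = vacuum k P :=
  LC.ext_resPairing fun f => by
    rw [resPairing_dualMonomial, resPairing_vacuum, ← constantCoeff_toMvPoly,
      MvPolynomial.constantCoeff_eq]

/-- Passing from $x_i$ to $z_i=x_i-x_i(P)$ shifts by constants, which derivations ignore. Both sides
are derivations up to the identification of the rings, and they agree on each $z_j$. -/
theorem toMvPoly_dirDeriv (P : V) (i) (f : SymDual k V) :
    toMvPoly k P (dirDeriv k (finBasis k V i) f) = MvPolynomial.pderiv i (toMvPoly k P f) := by
  obtain ⟨g, rfl⟩ := (toMvPoly k P).symm.surjective f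
  rw [AlgEquiv.apply_symm_apply]
  induction g using MvPolynomial.induction_on with
  | C c =>
    rw [← MvPolynomial.algebraMap_eq, AlgEquiv.commutes, Derivation.map_algebraMap,
      Derivation.map_algebraMap, map_zero]
  | add p q hp hq => simp only [map_add, hp, hq]
  | mul_X p j hp =>
    rw [map_mul, Derivation.leibniz, Derivation.leibniz, toMvPoly_symm_X, dirDeriv_localCoord,
      MvPolynomial.pderiv_X]
    simp only [smul_eq_mul, map_add, map_mul, hp, toMvPoly_localCoord, AlgEquiv.apply_symm_apply]
    congr 2
    simp only [Pi.single_apply, eq_comm]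
    split_ifs <;> simp

/-- Transpose of the fact that the coefficient of $X^a$ in $\partial_i g$ is $a_i+1$ times the
coefficient of $X^{a+e_i}$ in $g$. -/
theorem deriv_dualMonomial (P : V) (i) (a : Fin (finrank k V) →₀ ℕ) :
    LC.deriv k P (finBasis k V i) (dualMonomial k P a) =
      ((a i + 1 : ℕ) : k) • dualMonomial k P (a + Finsupp.single i 1) :=
  LC.ext_resPairing fun f => by
    rw [resPairing_deriv, map_smul, resPairing_dualMonomial, resPairing_dualMonomial,
      toMvPoly_dirDeriv, MvPolynomial.coeff_pderiv, smul_eq_mul, mul_comm]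
    push_cast
    ring

theorem resPairing_coordMonomial_dualMonomial (P : V) (a b : Fin (finrank k V) →₀ ℕ) :
    resPairing k P (coordMonomial k P b) (dualMonomial k P a) = if b = a then 1 else 0 := by
  rw [resPairing_dualMonomial, toMvPoly_coordMonomial, MvPolynomial.coeff_monomial]

theorem linearIndependent_dualMonomial (P : V) : LinearIndependent k (dualMonomial k P) := by
  rw [linearIndependent_iff']
  intro s g hg b hb
  have h := congrArg (resPairing k P (coordMonomial k P b)) hg
  simpa [map_sum, resPairing_coordMonomial_dualMonomial, hb] using h

/-- The functional of `η` kills a power of $\mathfrak m_P$, so it is determined by its values on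
finitely many monomials; these values are the coordinates of `η`. -/
theorem span_dualMonomial (P : V) : ⊤ ≤ Submodule.span k (Set.range (dualMonomial k P)) := by
  intro η _
  obtain ⟨N, hN⟩ := LC.exists_pow_smul_eq_zero k η
  have h : η = ∑ a ∈ boxExponents (finrank k V) N,
      resPairing k P (coordMonomial k P a) η • dualMonomial k P a := by
    refine LC.ext_resPairing fun f => ?_
    -- The box of exponents at most `N` needs vanishing on the power `N + 1` only, which is
    -- contained in the power `N`.
    refine (apply_eq_sum k P ((resPairing k P).flip η) N (fun f hf => ?_) f).trans ?_
    · rw [LinearMap.flip_apply, resPairing_apply,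
        hN f (Ideal.pow_le_pow_right N.le_succ hf), map_zero]
    · simp [map_sum, resPairing_dualMonomial, mul_comm]
  rw [h]
  exact Submodule.sum_mem _ fun a _ => Submodule.smul_mem _ _ (Submodule.subset_span ⟨a, rfl⟩)

/-- The basis of `LC(V, P)` dual to the monomials in the local coordinates. -/
noncomputable def dualMonomialBasis (P : V) : Basis (Fin (finrank k V) →₀ ℕ) k (LC k P) :=
  Basis.mk (linearIndependent_dualMonomial P) (span_dualMonomial P)

/-- The counterpart in $\operatorname{Sym}(V)$ of `deriv_dualMonomial`, with no numerical factor: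
the discrepancy is what the factorials repair. -/
theorem ι_mul_basis (i) (a : Fin (finrank k V) →₀ ℕ) :
    SymmetricAlgebra.ι k V (finBasis k V i) * (finBasis k V).symmetricAlgebra a =
      (finBasis k V).symmetricAlgebra (a + Finsupp.single i 1) := by
  apply (SymmetricAlgebra.equivMvPolynomial (finBasis k V)).injective
  simp [Basis.symmetricAlgebra, MvPolynomial.X, MvPolynomial.monomial_mul, add_comm]

theorem prod_factorial_add_single {n : ℕ} (a : Fin n →₀ ℕ) (i : Fin n) :
    ∏ j, ((a + Finsupp.single i 1 : Fin n →₀ ℕ) j).factorial = (a i + 1) * ∏ j, (a j).factorial := by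
  rw [← Finset.mul_prod_erase _ _ (Finset.mem_univ i),
    ← Finset.mul_prod_erase _ (fun j => (a j).factorial) (Finset.mem_univ i), ← mul_assoc]
  congr 1
  · simp [Nat.factorial_succ]
  · refine Finset.prod_congr rfl fun j hj => ?_
    simp [(Finset.ne_of_mem_erase hj).symm]

/-- Linearity of $\partial_\nu$ in $\nu$ passes through the pairing from polynomial functions. It
allows the comparison with multiplication by $\nu$ to be made on basis vectors alone. -/
theorem deriv_add (P v w : V) (η : LC k P) :
    LC.deriv k P (v + w) η = LC.deriv k P v η + LC.deriv k P w η :=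
  LC.ext_resPairing fun f => by
    simp only [map_add, resPairing_deriv, dirDeriv_add, LinearMap.add_apply]

theorem deriv_smul (P v : V) (c : k) (η : LC k P) :
    LC.deriv k P (c • v) η = c • LC.deriv k P v η :=
  LC.ext_resPairing fun f => by
    simp only [map_smul, resPairing_deriv, dirDeriv_smul, LinearMap.smul_apply]

/-- The operators `∂_ν` as a linear function of `ν`. -/
noncomputable def derivₗ (P : V) : V →ₗ[k] LC k P →ₗ[k] LC k P where
  toFun := LC.deriv k P
  map_add' v w := LinearMap.ext (deriv_add P v w)
  map_smul' c v := LinearMap.ext (deriv_smul P v c)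

/-! ### The isomorphism at a single point -/

section CharZero

variable [CharZero k]

/-- The isomorphism `Sym(V) ≃ LC(V, P)` taking `e ^ a` to `a!` times the element dual to `z ^ a`. -/
noncomputable def symEquivLC (P : V) : SymmetricAlgebra k V ≃ₗ[k] LC k P :=
  (finBasis k V).symmetricAlgebra.equiv
    ((dualMonomialBasis P).unitsSMul fun a =>
      -- Characteristic zero enters here: $a!$ must be invertible in `k` for the rescaled family to
      -- remain a basis.
      Units.mk0 ((∏ i, (a i).factorial : ℕ) : k)
        (Nat.cast_ne_zero.2 (Finset.prod_ne_zero_iff.2 fun i _ => (a i).factorial_ne_zero)))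
    (Equiv.refl _)

theorem symEquivLC_basis (P : V) (a : Fin (finrank k V) →₀ ℕ) :
    symEquivLC P ((finBasis k V).symmetricAlgebra a) =
      ((∏ i, (a i).factorial : ℕ) : k) • dualMonomial k P a := by
  rw [symEquivLC, Basis.equiv_apply, Basis.unitsSMul_apply, dualMonomialBasis]
  simp [Units.smul_def]

theorem symEquivLC_one (P : V) : symEquivLC P (1 : SymmetricAlgebra k V) = vacuum k P := by
  have h : (finBasis k V).symmetricAlgebra 0 = 1 := by
    simp [Basis.symmetricAlgebra]
  rw [← h, symEquivLC_basis, ← dualMonomial_zero]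
  simp

/-- For a basis vector $e_i$ both sides send $e^a$ to $(a_i+1)\,a!$ times the element dual to
$z^{a+e_i}$; linearity in `v` does the rest. -/
theorem symEquivLC_ι_mul (P v : V) (x : SymmetricAlgebra k V) :
    symEquivLC P (SymmetricAlgebra.ι k V v * x) = LC.deriv k P v (symEquivLC P x) := by
  have h (i) : (symEquivLC P).toLinearMap ∘ₗ
        LinearMap.mulLeft k (SymmetricAlgebra.ι k V (finBasis k V i)) =
      LC.deriv k P (finBasis k V i) ∘ₗ (symEquivLC P).toLinearMap := by
    refine (finBasis k V).symmetricAlgebra.ext fun a => ?_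
    simp only [LinearMap.comp_apply, LinearEquiv.coe_coe, LinearMap.mulLeft_apply]
    rw [ι_mul_basis, symEquivLC_basis, symEquivLC_basis, map_smul, deriv_dualMonomial,
      smul_smul, prod_factorial_add_single, Nat.cast_mul, mul_comm]
  -- With `x` fixed, both sides are linear maps in the vector, so the basis case suffices.
  have h' : (symEquivLC P).toLinearMap ∘ₗ LinearMap.mulRight k x ∘ₗ SymmetricAlgebra.ι k V =
      (derivₗ P).flip (symEquivLC P x) :=
    (finBasis k V).ext fun i => LinearMap.congr_fun (h i) x
  exact LinearMap.congr_fun h' v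

theorem symEquivLC_prod (P : V) (l : List V) :
    symEquivLC P (l.map (SymmetricAlgebra.ι k V)).prod = ket k P l := by
  induction l with
  | nil => exact symEquivLC_one P
  | cons v l ih =>
    rw [List.map_cons, List.prod_cons, symEquivLC_ι_mul, ih]
    rfl

/-- The residue is the pairing with the constant function `1`. Since $\partial_v 1=0$ it kills every
derivative, just as the counit kills every multiple of a vector. -/
theorem residue_symEquivLC (P : V) (x : SymmetricAlgebra k V) :
    residue k P (symEquivLC P x) = counit x := by
  rw [← resPairing_one]
  induction x using symmetricAlgebra_induction_left with
  | one => rw [symEquivLC_one, resPairing_vacuum, map_one, Bialgebra.counit_one]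
  | smul c x hx => rw [map_smul, map_smul, map_smul, hx]
  | add x y hx hy => rw [map_add, map_add, map_add, hx, hy]
  | ι_mul v x _ =>
    rw [symEquivLC_ι_mul, resPairing_deriv, Derivation.map_one_eq_zero, map_zero, counit_ι_mul,
      LinearMap.zero_apply]

/-- Testing against $\varphi\in V^*$, the vacuum gives $\varphi(P)$ and $\partial_v\eta$ gives
$\varphi(v)\operatorname{res}_P(\eta)$, which is the recursion of `symToV_one` and `symToV_ι_mul`.
-/
theorem derelictionAt_symEquivLC (P : V) (x : SymmetricAlgebra k V) :
    derelictionAt k P (symEquivLC P x) = symToV k P x := by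
  have key (φ : Dual k V) (η : LC k P) :
      φ (derelictionAt k P η) = resPairing k P (SymmetricAlgebra.ι k _ φ) η := by
    simp [derelictionAt, apply_evalEquiv_symm_apply]
  -- Linear forms separate the vectors of $V$.
  refine (forall_dual_apply_eq_zero_iff k _).1 ?_ |> sub_eq_zero.1
  intro φ
  rw [map_sub, sub_eq_zero, key]
  induction x using symmetricAlgebra_induction_left with
  | one => rw [symEquivLC_one, resPairing_vacuum, symToV_one]; simp [evalAt]
  | smul c x hx => simp only [map_smul, hx]
  | add x y hx hy => simp only [map_add, hx, hy]
  | ι_mul v x _ =>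
    rw [symEquivLC_ι_mul, resPairing_deriv, dirDeriv_ι, symToV_ι_mul,
      Algebra.algebraMap_eq_smul_one, map_smul, LinearMap.smul_apply, resPairing_one,
      residue_symEquivLC, map_smul, smul_eq_mul, smul_eq_mul, mul_comm]

/-- The vacuum is group-like because evaluation at $P$ is multiplicative. Multiplying by $v$ applies
$v\otimes1+1\otimes v$ to the coproduct, which pairs with $f\otimes g$ as $\partial_v f\otimes
g+f\otimes\partial_v g$, and this matches $\partial_v(fg)$. -/
theorem comul_symEquivLC (P : V) (x : SymmetricAlgebra k V) :
    TensorProduct.map (symEquivLC P).toLinearMap (symEquivLC P).toLinearMap (comul (R := k) x) =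
      comul (symEquivLC P x) := by
  change _ = LC.comul k P _
  refine resPairing₂_separating k P _ _ fun f g => ?_
  rw [resPairing₂_comul]
  -- The inductive step uses the hypothesis with `f` or `g` replaced by its derivative.
  induction x using symmetricAlgebra_induction_left generalizing f g with
  | one =>
    rw [symEquivLC_one, Bialgebra.comul_one, Algebra.TensorProduct.one_def, TensorProduct.map_tmul]
    simp [symEquivLC_one, resPairing₂, resPairing_vacuum]
  | smul c x hx => simp only [map_smul, hx]
  | add x y hx hy => simp only [map_add, hx, hy]
  | ι_mul v x hx =>
    -- Stated for an arbitrary tensor in place of the coproduct of `x`, so that it can be checked on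
    -- pure tensors.
    have h (ξ : SymmetricAlgebra k V ⊗[k] SymmetricAlgebra k V) :
        resPairing₂ k P f g (TensorProduct.map (symEquivLC P).toLinearMap
          (symEquivLC P).toLinearMap (comul (R := k) (SymmetricAlgebra.ι k V v) * ξ)) =
        resPairing₂ k P (dirDeriv k v f) g (TensorProduct.map (symEquivLC P).toLinearMap
          (symEquivLC P).toLinearMap ξ) +
        resPairing₂ k P f (dirDeriv k v g) (TensorProduct.map (symEquivLC P).toLinearMap
          (symEquivLC P).toLinearMap ξ) := by
      induction ξ with
      | zero => simp
      | add a b ha hb => simp only [mul_add, map_add, ha, hb]; ring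
      | tmul a b =>
        simp [add_mul, resPairing₂, symEquivLC_ι_mul, resPairing_deriv]
    rw [Bialgebra.comul_mul, h, hx, hx, symEquivLC_ι_mul, resPairing_deriv, Derivation.leibniz,
      map_add, LinearMap.add_apply, smul_eq_mul, smul_eq_mul, mul_comm g, add_comm]

/-- The isomorphism of coalgebras `Sym(V) ≃ LC(V, P)`. -/
noncomputable def symCoalgEquivLC (P : V) : SymmetricAlgebra k V ≃ₗc[k] LC k P where
  __ := symEquivLC P
  counit_comp := LinearMap.ext (residue_symEquivLC P)
  map_comp_comul := LinearMap.ext (comul_symEquivLC P)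

/-! ### The direct sum over all points -/

variable [DecidableEq V]

variable (k V) in
/-- The linear isomorphism underlying `bangEquivSym`. -/
noncomputable def bangLinearEquivSym : Bang k V ≃ₗ[k] (V →₀ SymmetricAlgebra k V) :=
  .ofLinearMap
    (DFinsupp.lsum k fun P => Finsupp.lsingle P ∘ₗ (symEquivLC P).symm.toLinearMap)
    (Finsupp.lsum k fun P => DFinsupp.lsingle P ∘ₗ (symEquivLC P).toLinearMap)
    (Finsupp.lhom_ext fun P x => by simp)
    (DFinsupp.lhom_ext fun P η => by simp)

theorem bangLinearEquivSym_single (P : V) (η : LC k P) :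
    bangLinearEquivSym k V (DFinsupp.single P η) = Finsupp.single P ((symEquivLC P).symm η) := by
  simp [bangLinearEquivSym]

variable (k V) in
/-- The isomorphism of coalgebras `!V ≃ ⨁_P Sym_P(V)`. -/
noncomputable def bangEquivSym : Bang k V ≃ₗc[k] (V →₀ SymmetricAlgebra k V) where
  __ := bangLinearEquivSym k V
  counit_comp := DFinsupp.lhom_ext fun P η => by
    change counit (bangLinearEquivSym k V (DFinsupp.single P η)) =
      counit (R := k) (DFinsupp.single P η : Bang k V)
    rw [bangLinearEquivSym_single, Finsupp.counit_single, DFinsupp.counit_single]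
    exact CoalgHomClass.counit_comp_apply (symCoalgEquivLC P).symm η
  map_comp_comul := DFinsupp.lhom_ext fun P η => by
    change TensorProduct.map (bangLinearEquivSym k V).toLinearMap
        (bangLinearEquivSym k V).toLinearMap (comul (R := k) (DFinsupp.single P η : Bang k V)) =
      comul (bangLinearEquivSym k V (DFinsupp.single P η))
    -- The coproduct of a direct sum is that of the summand pushed forward along its inclusion, so
    -- compatibility with inclusions reduces the claim to the point $P$.
    have h : (bangLinearEquivSym k V).toLinearMap ∘ₗ DFinsupp.lsingle P =
        Finsupp.lsingle P ∘ₗ (symEquivLC P).symm.toLinearMap :=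
      LinearMap.ext fun η => bangLinearEquivSym_single P η
    have hP : TensorProduct.map (symEquivLC P).symm.toLinearMap (symEquivLC P).symm.toLinearMap
        (comul (R := k) η) = comul ((symEquivLC P).symm η) :=
      CoalgHomClass.map_comp_comul_apply (symCoalgEquivLC P).symm η
    rw [bangLinearEquivSym_single, Finsupp.comul_single, DFinsupp.comul_single, ← hP,
      TensorProduct.map_map, TensorProduct.map_map, h]

theorem bangEquivSym_single (P : V) (η : LC k P) :
    bangEquivSym k V (DFinsupp.single P η) = Finsupp.single P ((symEquivLC P).symm η) :=
  bangLinearEquivSym_single P η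

theorem dereliction_eq (η : Bang k V) :
    dereliction k V η = Finsupp.lsum k (fun P => symToV k P) (bangEquivSym k V η) := by
  have h : dereliction k V =
      Finsupp.lsum k (fun P => symToV k P) ∘ₗ (bangEquivSym k V).toLinearEquiv.toLinearMap := by
    refine DFinsupp.lhom_ext fun P η => ?_
    change _ = Finsupp.lsum k (fun P => symToV k P) (bangEquivSym k V (DFinsupp.single P η))
    rw [bangEquivSym_single, Finsupp.lsum_single, ← derelictionAt_symEquivLC,
      LinearEquiv.apply_symm_apply, dereliction, DFinsupp.lsum_single]
  exact LinearMap.congr_fun h η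

end CharZero

end Duality

end CofreeCoalgebra

theorem lemma2p13 {k V : Type*} [Field k] [IsAlgClosed k] [CharZero k] [AddCommGroup V]
    [Module k V] [FiniteDimensional k V] [DecidableEq V] :
    ∃ Ψ : CofreeCoalgebra.Bang k V ≃ₗc[k] (V →₀ SymmetricAlgebra k V),
      (∀ (P : V) (l : List V), Ψ (DFinsupp.single P (CofreeCoalgebra.ket k P l)) =
        Finsupp.single P (l.map (SymmetricAlgebra.ι k V)).prod) ∧
      ∀ η : CofreeCoalgebra.Bang k V, CofreeCoalgebra.dereliction k V η =
        Finsupp.lsum k (fun P => CofreeCoalgebra.symToV k P) (Ψ η) := by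
  refine ⟨CofreeCoalgebra.bangEquivSym k V, fun P l => ?_, CofreeCoalgebra.dereliction_eq⟩
  -- On each summand $\Psi$ is the inverse of `symEquivLC`, so the ket is first written as the image
  -- of the product of its vectors.
  rw [CofreeCoalgebra.bangEquivSym_single, ← CofreeCoalgebra.symEquivLC_prod,
    LinearEquiv.symm_apply_apply]
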